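/- **Theorem.** Let $\delta_1,\gamma>0$ and let $Z=(Z_\tau)_{\tau\ge 0}$ be a driftless subordinator (a Lévy process with $Z_0=0$ and nondecreasing right-continuous paths) with Lévy density $$w(u)=\frac{\delta_1}{2\sqrt{2\pi}}\,u^{-3/2}(1+\gamma^2u)\,e^{-\gamma^2u/2},\qquad u>0,$$ that is, $\mathbb E\,e^{-sZ_\tau}=\exp\bigl(-\tau\int_0^\infty(1-e^{-su})w(u)\,du\bigr)$ for all $s,\tau\ge 0$. For $t>0$ let $T_t=\inf\{\tau>0: Z_\tau\ge t\}$ be the first-exit time. Then, for every $t>0$, $T_t$ is almost surely finite, and its law is absolutely continuous on $(0,\infty)$ with (nonnegative, measurable) density $x\mapsto h(x,t)$, where $$h(x,t)=\bigl((p*q)*r\bigr)(x,t)=\int_0^t\Bigl(\int_{[0,u]}p(x,u-\tau)\,q(x,d\tau)\Bigr)\,r(x,t-u)\,du ,$$ and $p,q,r$ are as follows. * With $\operatorname{erf}(y)=\frac{2}{\sqrt\pi}\int_0^y e^{-s^2}ds$ and $\Gamma(a,y)=\int_y^\infty s^{a-1}e^{-s}ds$, $$p(x,t)=-\frac{\delta_1\gamma}{2}\operatorname{erf}\Bigl(\frac{\gamma\sqrt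 t}{\sqrt2}\Bigr)+\frac{\delta_1\gamma}{2}+\frac{\delta_1\gamma}{4\sqrt\pi}\,\Gamma\Bigl(-\frac12,\frac{\gamma^2t}{2}\Bigr).$$ * With $c=\frac{x\gamma^2\delta_1}{2\sqrt2}$ and $I_0(z)=\sum_{k\ge0}\frac{(z/2)^{2k}}{(k!)^2}$ the modified Bessel function of the first kind, $q(x,\cdot)$ is the measure on $[0,\infty)$ $$q(x,dt)=e^{-x\gamma\delta_1/2}\,e^{-t\gamma^2/2}\int_{[0,\infty)}k(u,dt)\,\Bigl(I_0'\bigl(2\sqrt{cu}\bigr)\sqrt{\tfrac{c}{u}}+\delta(u)\Bigr)du,$$ where $\delta$ is the Dirac delta function (the unit mass at $u=0$), $k(u,dt)=\frac{t^{-3/2}}{2\sqrt\pi}\,u\,e^{-u^2/(4t)}\,dt$ on $(0,\infty)$ for $u>0$, and $k(0,dt)$ is the weak limit of $k(u,dt)$ as $u\downarrow0$, i.e. the unit mass at $t=0$. Thus the Dirac term contributes to $q(x,\cdot)$ an atom of mass $e^{-x\gamma\delta_1/2}$ at $t=0$. * $$r(x,t)=\frac{x\,\delta_1\,e^{-\gamma^2t/2}\,e^{x\delta_1\gamma/2}\,e^{-\delta_1^2x^2/(8t)}}{\sqrt\pi\,(2t)^{3/2}}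 .$$ -/

import Mathlib

open MeasureTheory ProbabilityTheory Set Filter Topology
open scoped NNReal ENNReal

/-! ### Special functions -/

/-- The error function `erf x = (2 / √π) ∫₀ˣ e^{-s²} ds`. -/
noncomputable def erf (x : ℝ) : ℝ :=
  2 / Real.sqrt Real.pi * ∫ s in (0 : ℝ)..x, Real.exp (-s ^ 2)

/-- The upper incomplete gamma function `Γ(a, x) = ∫ₓ^∞ s^{a-1} e^{-s} ds`, for `x > 0`. -/
noncomputable def upperGamma (a x : ℝ) : ℝ :=
  ∫ s in Ioi x, s ^ (a - 1) * Real.exp (-s)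

/-- The modified Bessel function of the first kind of order `0`,
`I₀(z) = ∑ₖ (z/2)^{2k} / (k!)²`. -/
noncomputable def besselI0 (z : ℝ) : ℝ :=
  ∑' k : ℕ, (z / 2) ^ (2 * k) / (k.factorial : ℝ) ^ 2

/-! ### Subordinators and first-exit times -/

/-- A subordinator: a Lévy process started at `0` with nondecreasing right-continuous paths (left
limits exist by monotonicity). -/
structure IsSubordinator {Ω : Type*} [MeasurableSpace Ω] (Z : ℝ≥0 → Ω → ℝ) (P : Measure Ω) :
    Prop where
  measurable : ∀ τ, Measurable (Z τ)
  zero : ∀ᵐ ω ∂P, Z 0 ω = 0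
  indep : HasIndepIncrements Z P
  stationary : ∀ σ τ, IdentDistrib (fun ω ↦ Z (σ + τ) ω - Z σ ω) (Z τ) P P
  mono : ∀ᵐ ω ∂P, Monotone fun τ ↦ Z τ ω
  rightCont : ∀ᵐ ω ∂P, ∀ τ, ContinuousWithinAt (fun σ ↦ Z σ ω) (Ici τ) τ

/-- The Laplace exponent `ψ(s) = ∫₀^∞ (1 - e^{-su}) w(u) du` of a Lévy density `w`. -/
noncomputable def laplaceExponent (w : ℝ → ℝ) (s : ℝ) : ℝ :=
  ∫ u in Ioi (0 : ℝ), (1 - Real.exp (-s * u)) * w u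

/-- The process `Z` has Lévy density `w` (and no drift): `w ≥ 0` on `(0, ∞)`,
`∫₀^∞ min(1, u) w(u) du < ∞` and `E e^{-s Z_τ} = e^{-τ ψ(s)}` for `s, τ ≥ 0`. -/
structure HasLevyDensity {Ω : Type*} [MeasurableSpace Ω] (Z : ℝ≥0 → Ω → ℝ) (w : ℝ → ℝ)
    (P : Measure Ω) : Prop where
  nonneg : ∀ u, 0 < u → 0 ≤ w u
  integrable : IntegrableOn (fun u ↦ min 1 u * w u) (Ioi 0)
  laplace : ∀ (τ : ℝ≥0) (s : ℝ), 0 ≤ s →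
    ∫ ω, Real.exp (-s * Z τ ω) ∂P = Real.exp (-(τ : ℝ) * laplaceExponent w s)

/-- The first-exit time `T_t = inf {τ > 0 : Z_τ ≥ t}`. -/
noncomputable def firstExit {Ω : Type*} (Z : ℝ≥0 → Ω → ℝ) (t : ℝ) (ω : Ω) : ℝ :=
  ((sInf {τ : ℝ≥0 | 0 < τ ∧ t ≤ Z τ ω} : ℝ≥0) : ℝ)

/-- `w(u) = δ₁ / (2√(2π)) · u^{-3/2} (1 + γ² u) e^{-γ² u / 2}`. -/
noncomputable def igLevyDensity (δ₁ γ u : ℝ) : ℝ :=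
  δ₁ / (2 * Real.sqrt (2 * Real.pi)) * u ^ (-(3 / 2) : ℝ) * (1 + γ ^ 2 * u) *
    Real.exp (-(γ ^ 2 * u) / 2)

/-! ### The kernel `u e^{-u²/(4t)} t^{-3/2} / (2√π)` -/

/-- `k(u, t) = t^{-3/2} / (2√π) · u e^{-u²/(4t)}`, for `u, t > 0`. -/
noncomputable def smirnovDensity (u t : ℝ) : ℝ :=
  t ^ (-(3 / 2) : ℝ) / (2 * Real.sqrt Real.pi) * (u * Real.exp (-u ^ 2 / (4 * t)))

/-- The measures `k(u, t) dt` on `(0, ∞)`, `u > 0`, extended to `u = 0` by their weak limit, the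
unit mass at `t = 0` (see `tendsto_smirnovDensity`); the value at `u < 0` plays no role. -/
noncomputable def smirnovKernel : Kernel ℝ ℝ where
  toFun u := if 0 < u then
      (volume.restrict (Ioi 0)).withDensity fun t ↦ ENNReal.ofReal (smirnovDensity u t)
    else Measure.dirac 0
  measurable' := by
    refine Measurable.ite measurableSet_Ioi ?_ measurable_const
    refine Measure.measurable_of_measurable_coe _ fun s hs ↦ ?_
    simp_rw [withDensity_apply _ hs]
    refine Measurable.lintegral_prod_right' (f := fun p : ℝ × ℝ ↦
      ENNReal.ofReal (smirnovDensity p.1 p.2)) ?_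
    unfold smirnovDensity
    fun_prop

/-- `∫₀^∞ k(1, t) dt = 1`. -/
lemma integral_smirnovDensity_one : ∫ t in Ioi (0 : ℝ), smirnovDensity 1 t = 1 := by
  have h := integral_comp_rpow_Ioi (fun t ↦ smirnovDensity 1 t) (p := -1) (by norm_num)
  rw [← h]
  have e : ∀ y ∈ Ioi (0 : ℝ), (|(-1 : ℝ)| * y ^ ((-1 : ℝ) - 1)) • smirnovDensity 1 (y ^ (-1 : ℝ))
      = 1 / (2 * Real.sqrt Real.pi) * (y ^ ((1 / 2 : ℝ) - 1) * Real.exp (-(1 / 4 * y))) := by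
    intro y hy
    have hy : 0 < y := hy
    have h1 : (y ^ (-1 : ℝ)) ^ (-(3 / 2) : ℝ) = y ^ (3 / 2 : ℝ) := by
      rw [← Real.rpow_mul hy.le]; norm_num
    have h2 : y ^ ((-1 : ℝ) - 1) * y ^ (3 / 2 : ℝ) = y ^ ((1 / 2 : ℝ) - 1) := by
      rw [← Real.rpow_add hy]; norm_num
    have h3 : -1 ^ 2 / (4 * y ^ (-1 : ℝ)) = -(1 / 4 * y) := by
      rw [Real.rpow_neg_one]; field_simp
    unfold smirnovDensity
    rw [h1, h3, ← h2, abs_neg, abs_one, smul_eq_mul]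
    ring
  rw [setIntegral_congr_fun measurableSet_Ioi e, integral_const_mul,
    Real.integral_rpow_mul_exp_neg_mul_Ioi (by norm_num) (by norm_num), Real.Gamma_one_half_eq,
    show (1 / (1 / 4 : ℝ)) = 2 ^ (2 : ℝ) by norm_num, ← Real.rpow_mul (by norm_num)]
  have : Real.sqrt Real.pi ≠ 0 := by positivity
  norm_num
  field_simp

/-- As `u ↓ 0`, the measures `k(u, t) dt` converge weakly to the unit mass at `0`. -/
lemma tendsto_smirnovDensity (f : ℝ → ℝ) (hf : Continuous f) (hb : ∃ C, ∀ t, |f t| ≤ C) :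
    Tendsto (fun u ↦ ∫ t in Ioi (0 : ℝ), smirnovDensity u t * f t) (𝓝[>] 0) (𝓝 (f 0)) := by
  obtain ⟨C, hC⟩ := hb
  have hint : IntegrableOn (smirnovDensity 1) (Ioi 0) :=
    by_contra fun h ↦ by
      have := integral_smirnovDensity_one
      rw [integral_undef h] at this
      norm_num at this
  have hlim : Tendsto (fun u : ℝ ↦ ∫ t in Ioi (0 : ℝ), smirnovDensity 1 t * f (u ^ 2 * t))
      (𝓝[>] 0) (𝓝 (∫ t in Ioi (0 : ℝ), smirnovDensity 1 t * f 0)) := by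
    refine tendsto_integral_filter_of_dominated_convergence
      (fun t ↦ ‖smirnovDensity 1 t‖ * C) ?_ ?_ (hint.norm.mul_const C) ?_
    · refine Eventually.of_forall fun u ↦ hint.aestronglyMeasurable.mul ?_
      exact (by fun_prop : Continuous fun t ↦ f (u ^ 2 * t)).aestronglyMeasurable
    · refine Eventually.of_forall fun u ↦ Eventually.of_forall fun t ↦ ?_
      rw [norm_mul]
      exact mul_le_mul_of_nonneg_left (hC _) (norm_nonneg _)
    · refine Eventually.of_forall fun t ↦ ?_
      have : Tendsto (fun u : ℝ ↦ smirnovDensity 1 t * f (u ^ 2 * t)) (𝓝 0)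
          (𝓝 (smirnovDensity 1 t * f (0 ^ 2 * t))) :=
        (by fun_prop : Continuous fun u : ℝ ↦ smirnovDensity 1 t * f (u ^ 2 * t)).tendsto 0
      simpa using this.mono_left nhdsWithin_le_nhds
  rw [integral_mul_const, integral_smirnovDensity_one, one_mul] at hlim
  refine hlim.congr' ?_
  filter_upwards [self_mem_nhdsWithin] with u hu
  have hu : 0 < u := hu
  have h := integral_comp_mul_left_Ioi (fun t ↦ smirnovDensity u t * f t) 0
    (show 0 < u ^ 2 by positivity)
  rw [mul_zero, smul_eq_mul, eq_inv_mul_iff_mul_eq₀ (by positivity)] at h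
  rw [← h, ← integral_const_mul]
  refine setIntegral_congr_fun measurableSet_Ioi fun t ht ↦ ?_
  have ht : 0 < t := ht
  have h1 : (u ^ 2 * t) ^ (-(3 / 2) : ℝ) = (u ^ 3)⁻¹ * t ^ (-(3 / 2) : ℝ) := by
    rw [Real.mul_rpow (by positivity) ht.le, ← Real.rpow_natCast, ← Real.rpow_mul hu.le,
      show ((2 : ℕ) : ℝ) * -(3 / 2) = -((3 : ℕ) : ℝ) by norm_num, Real.rpow_neg hu.le,
      Real.rpow_natCast]
  have h2 : -u ^ 2 / (4 * (u ^ 2 * t)) = -1 ^ 2 / (4 * t) := by field_simp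
  simp only [smirnovDensity]
  rw [h1, h2]
  field_simp

/-! ### The factors `p`, `q`, `r` and the function `h` -/

/-- `p(x, t) = -δ₁γ erf(γ√t/√2)/2 + δ₁γ/2 + Γ(-1/2, γ²t/2) δ₁γ/(4√π)` (independent of `x`). -/
noncomputable def pFactor (δ₁ γ t : ℝ) : ℝ :=
  -(δ₁ * γ * erf (γ * Real.sqrt t / Real.sqrt 2)) / 2 + δ₁ * γ / 2 +
    upperGamma (-(1 / 2)) (γ ^ 2 * t / 2) * (δ₁ * γ) / (4 * Real.sqrt Real.pi)

/-- The constant `c = xγ²δ₁/(2√2)`. -/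
noncomputable def besselScale (δ₁ γ x : ℝ) : ℝ :=
  x * γ ^ 2 * δ₁ / (2 * Real.sqrt 2)

/-- The measure `(I₀′(2√(cu)) √(c/u) + δ(u)) du` on `[0, ∞)`, where `δ` is the Dirac delta. -/
noncomputable def besselMeasure (δ₁ γ x : ℝ) : Measure ℝ :=
  (volume.restrict (Ioi 0)).withDensity (fun u ↦ ENNReal.ofReal
    (deriv besselI0 (2 * Real.sqrt (besselScale δ₁ γ x * u)) *
      Real.sqrt (besselScale δ₁ γ x / u))) + Measure.dirac 0

/-- The measure `q(x, dt)` on `[0, ∞)`: with `k(u, dt) = t^{-3/2}/(2√π) · u e^{-u²/(4t)} dt`,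
`q(x, dt) = e^{-xγδ₁/2} e^{-tγ²/2} ∫_{[0,∞)} k(u, dt) (I₀′(2√(cu)) √(c/u) + δ(u)) du`. -/
noncomputable def qFactor (δ₁ γ x : ℝ) : Measure ℝ :=
  ((besselMeasure δ₁ γ x).bind smirnovKernel).withDensity fun t ↦
    ENNReal.ofReal (Real.exp (-(x * γ * δ₁) / 2) * Real.exp (-(t * γ ^ 2) / 2))

/-- `r(x, t) = xδ₁ e^{-γ²t/2} e^{xδ₁γ/2} e^{-δ₁²x²/(8t)} / (√π (2t)^{3/2})`. -/
noncomputable def rFactor (δ₁ γ x t : ℝ) : ℝ :=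
  x * δ₁ * Real.exp (-(γ ^ 2 * t) / 2) * Real.exp (x * δ₁ * γ / 2) *
    Real.exp (-(δ₁ ^ 2 * x ^ 2) / (8 * t)) / (Real.sqrt Real.pi * (2 * t) ^ (3 / 2 : ℝ))

/-- `(f * μ)(t) = ∫_{[0,t]} f(t - τ) μ(dτ)`. -/
noncomputable def convMeasure (f : ℝ → ℝ) (μ : Measure ℝ) (t : ℝ) : ℝ :=
  ∫ τ in Icc 0 t, f (t - τ) ∂μ

/-- `(f * g)(t) = ∫₀ᵗ f(u) g(t - u) du`. -/
noncomputable def convFun (f g : ℝ → ℝ) (t : ℝ) : ℝ :=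
  ∫ u in (0 : ℝ)..t, f u * g (t - u)

/-- `h(x, t) = ((p * q) * r)(x, t)`, the convolutions being taken in `t`. -/
noncomputable def exitDensity (δ₁ γ x t : ℝ) : ℝ :=
  convFun (convMeasure (pFactor δ₁ γ) (qFactor δ₁ γ x)) (rFactor δ₁ γ x) t

/-!
Put `a = γ²/2`, `K = δ₁/√2` and `g(t) = e^{-at} / √(πt)` for `t > 0`. The Lévy density is minus the
derivative of `K g`, so `K g` is the tail of the Lévy measure, and integration by parts gives the
Laplace exponent `ψ(s) = K s / √(s + a)` (`laplaceExponent_igLevyDensity`). In `p` the error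
function terms cancel, which leaves `p = K g` on `(0, ∞)` (`pFactor_eq`). The measure
`q(x, ·) * r(x, t) dt` has Laplace transform `e^{-xψ(s)}`
(`laplaceTransform_qFactor_conv_rMeasure`), so by uniqueness of Laplace transforms
(`measure_ext_of_laplaceTransform`) it is the law `μ_x` of `Z_x`,
and `h(x, t) = ∫ p(t - τ) μ_x(dτ)` (`exitDensity_eq`).

Since paths are nondecreasing and right-continuous, `T_t > x` if and only if `Z_x < t`, almost
surely (`IsSubordinator.ae_lt_firstExit_iff`), so it has to be shown that
`∫ₓ^∞ h(v, t) dv = μ_x(-∞, t)` for all `x ≥ 0`. Let `U = ∫₀^∞ μ_v dv` be the potential measure.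
Its Laplace transform `1/ψ` identifies it as an explicit measure, built from `g`
(`IsLaplaceSemigroup.bind_eq`). With
`g * g = e^{-a·}` this yields `∫ p(t - τ) U(dτ) = 1` for every `t > 0`, not only for almost every
`t` as Laplace inversion would (`lintegral_levyTail_potentialMeasure`). As `μ_{x+v} = μ_x * μ_v`,
the function `∫ₓ^∞ h(v, ·) dv = ∫₀^∞ p * μ_x * μ_v dv = μ_x * (p * U)` takes the value
`μ_x(-∞, t)` at `t` (`IsLaplaceSemigroup.lintegral_Ioi_levyTail`).

All convolutions are handled as integrals with values in `[0, ∞]`, so that Tonelli's theorem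
applies without integrability conditions. The total mass `∫₀^∞ h(x, t) dx = 1` shows that `h(x, t)`
is finite for almost every `x`, which is what the passage to the real-valued `h` needs.
-/

/-! ### Laplace transforms of measures on the half-line -/

/-- The Laplace transform `s ↦ ∫ e^{-sx} μ(dx)` of a measure on `ℝ`, with values in `[0, ∞]`. -/
noncomputable def laplaceTransform (μ : Measure ℝ) (s : ℝ) : ℝ≥0∞ :=
  ∫⁻ x, ENNReal.ofReal (Real.exp (-s * x)) ∂μ

/-- A finite measure on `[0, 1]` is determined by its moments. -/
lemma unitInterval_measure_ext_of_moments {μ ν : Measure unitInterval} [IsFiniteMeasure μ]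
    [IsFiniteMeasure ν] (h : ∀ n : ℕ, ∫ y, (y : ℝ) ^ n ∂μ = ∫ y, (y : ℝ) ^ n ∂ν) : μ = ν := by
  have hint : ∀ (ρ : Measure unitInterval) [IsFiniteMeasure ρ] (f : C(unitInterval, ℝ)),
      Integrable (fun y ↦ f y) ρ := fun ρ _ f ↦
    Integrable.of_bound f.continuous.aestronglyMeasurable ‖f‖
      (Eventually.of_forall fun y ↦ f.norm_coe_le_norm y)
  have hpoly : ∀ q : Polynomial ℝ, ∫ y : unitInterval, q.eval (y : ℝ) ∂μ =
      ∫ y : unitInterval, q.eval (y : ℝ) ∂ν := by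
    intro q
    have hi : ∀ (ρ : Measure unitInterval) [IsFiniteMeasure ρ] (n : ℕ),
        Integrable (fun y : unitInterval ↦ q.coeff n * (y : ℝ) ^ n) ρ := fun ρ _ n ↦
      hint ρ ⟨fun y ↦ q.coeff n * (y : ℝ) ^ n, by fun_prop⟩
    simp_rw [Polynomial.eval_eq_sum_range]
    rw [integral_finsetSum _ fun n _ ↦ hi μ n, integral_finsetSum _ fun n _ ↦ hi ν n]
    exact Finset.sum_congr rfl fun n _ ↦ by rw [integral_const_mul, integral_const_mul, h n]
  refine ext_of_forall_integral_eq_of_IsFiniteMeasure fun f ↦ ?_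
  -- Weierstrass: replacing `f` by a polynomial within `ε` costs at most `ε (|μ| + |ν|)`.
  refine eq_of_forall_dist_le fun ε hε ↦ ?_
  set M : ℝ := μ.real univ + ν.real univ + 1
  have hM : 0 < M := by positivity
  obtain ⟨q, hq⟩ := exists_polynomial_near_continuousMap 0 1 (f : C(unitInterval, ℝ)) (ε / M)
    (by positivity)
  have happrox : ∀ (ρ : Measure unitInterval) [IsFiniteMeasure ρ],
      ‖∫ y, f y ∂ρ - ∫ y : unitInterval, q.eval (y : ℝ) ∂ρ‖ ≤ ε / M * ρ.real univ := by
    intro ρ _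
    have hf : Integrable (fun y ↦ f y) ρ := hint ρ f.toContinuousMap
    have hqi : Integrable (fun y : unitInterval ↦ q.eval (y : ℝ)) ρ :=
      hint ρ (q.toContinuousMapOn _)
    rw [← integral_sub hf hqi]
    refine norm_integral_le_of_norm_le_const (Eventually.of_forall fun y ↦ ?_)
    have := (ContinuousMap.norm_coe_le_norm
      (q.toContinuousMapOn (Icc 0 1) - f.toContinuousMap) y).trans hq.le
    rw [norm_sub_rev]
    simpa using this
  have h1 := happrox μ
  have h2 := happrox ν
  rw [hpoly q] at h1
  rw [dist_eq_norm]
  calc ‖∫ y, f y ∂μ - ∫ y, f y ∂ν‖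
      ≤ ε / M * μ.real univ + ε / M * ν.real univ := by
        refine (norm_sub_le_norm_sub_add_norm_sub _ _ _).trans (add_le_add h1 ?_)
        rwa [norm_sub_rev]
    _ ≤ ε / M * M := by
        rw [← mul_add]; gcongr; simp [M]
    _ = ε := by field_simp

lemma ae_nonneg_of_measure_Iio {μ : Measure ℝ} (hμ : μ (Iio 0) = 0) : ∀ᵐ x ∂μ, 0 ≤ x := by
  rw [ae_iff]; simpa [Iio] using hμ

/-- A finite measure on `[0, ∞)` is determined by the values of its Laplace transform at the
natural numbers: these are the moments of its image under `x ↦ e^{-x}`. -/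
lemma measure_ext_of_laplaceTransform_nat {μ ν : Measure ℝ} [IsFiniteMeasure μ]
    [IsFiniteMeasure ν] (hμ : μ (Iio 0) = 0) (hν : ν (Iio 0) = 0)
    (h : ∀ n : ℕ, laplaceTransform μ n = laplaceTransform ν n) : μ = ν := by
  set φ : ℝ → unitInterval := fun x ↦ projIcc 0 1 zero_le_one (Real.exp (-x))
  have hφ : Measurable φ := by
    have : Continuous φ := by fun_prop
    exact this.measurable
  have hval : ∀ x : ℝ, 0 ≤ x → (φ x : ℝ) = Real.exp (-x) := fun x hx ↦ by
    have : Real.exp (-x) ∈ Icc (0 : ℝ) 1 := ⟨(Real.exp_pos _).le, by simpa using hx⟩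
    simp only [φ]
    rw [projIcc_of_mem zero_le_one this]
  have hmom : ∀ (ρ : Measure ℝ), ρ (Iio 0) = 0 → ∀ n : ℕ,
      ∫ y, (y : ℝ) ^ n ∂(ρ.map φ) = (laplaceTransform ρ n).toReal := by
    intro ρ hρ n
    rw [integral_map hφ.aemeasurable (by fun_prop), laplaceTransform,
      integral_eq_lintegral_of_nonneg_ae]
    · congr 1
      refine lintegral_congr_ae ?_
      filter_upwards [ae_nonneg_of_measure_Iio hρ] with x hx
      rw [hval x hx, ← Real.exp_nat_mul]
      ring_nf
    · exact Eventually.of_forall fun x ↦ pow_nonneg (φ x).2.1 n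
    · exact ((measurable_subtype_coe.comp hφ).pow_const n).aestronglyMeasurable
  have hmap : μ.map φ = ν.map φ :=
    unitInterval_measure_ext_of_moments fun n ↦ by rw [hmom μ hμ, hmom ν hν, h]
  have hinv : ∀ (ρ : Measure ℝ), ρ (Iio 0) = 0 →
      (ρ.map φ).map (fun y : unitInterval ↦ -Real.log (y : ℝ)) = ρ := by
    intro ρ hρ
    rw [Measure.map_map (by fun_prop) hφ]
    conv_rhs => rw [← Measure.map_id (μ := ρ)]
    refine Measure.map_congr ?_
    filter_upwards [ae_nonneg_of_measure_Iio hρ] with x hx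
    simp [hval x hx]
  rw [← hinv μ hμ, hmap, hinv ν hν]

/-- Two measures on `[0, ∞)` whose Laplace transforms are finite and agree on `(0, ∞)` are equal. -/
lemma measure_ext_of_laplaceTransform {μ ν : Measure ℝ} (hμ : μ (Iio 0) = 0) (hν : ν (Iio 0) = 0)
    (hfin : laplaceTransform μ 1 ≠ ∞)
    (h : ∀ s : ℝ, 0 < s → laplaceTransform μ s = laplaceTransform ν s) : μ = ν := by
  set e : ℝ → ℝ≥0∞ := fun x ↦ ENNReal.ofReal (Real.exp (-x))
  have he : Measurable e := by fun_prop
  have htilt : ∀ (ρ : Measure ℝ) (s : ℝ),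
      laplaceTransform (ρ.withDensity e) s = laplaceTransform ρ (s + 1) := by
    intro ρ s
    rw [laplaceTransform, lintegral_withDensity_eq_lintegral_mul _ he (by fun_prop)]
    refine lintegral_congr fun x ↦ ?_
    simp only [Pi.mul_apply, e]
    rw [← ENNReal.ofReal_mul (Real.exp_pos _).le, ← Real.exp_add]
    ring_nf
  have huniv : ∀ ρ : Measure ℝ, ρ.withDensity e univ = laplaceTransform ρ 1 := by
    intro ρ
    have := htilt ρ 0
    simpa [laplaceTransform] using this
  have hfμ : IsFiniteMeasure (μ.withDensity e) := ⟨by rw [huniv]; exact hfin.lt_top⟩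
  have hfν : IsFiniteMeasure (ν.withDensity e) :=
    ⟨by rw [huniv, ← h 1 one_pos]; exact hfin.lt_top⟩
  have key : μ.withDensity e = ν.withDensity e := by
    refine measure_ext_of_laplaceTransform_nat ?_ ?_ fun n ↦ ?_
    · exact withDensity_absolutelyContinuous _ _ hμ
    · exact withDensity_absolutelyContinuous _ _ hν
    · rw [htilt, htilt, h _ (by positivity)]
  have hback : ∀ ρ : Measure ℝ,
      (ρ.withDensity e).withDensity (fun x ↦ ENNReal.ofReal (Real.exp x)) = ρ := by
    intro ρ
    rw [← withDensity_mul _ he (by fun_prop)]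
    have : (e * fun x ↦ ENNReal.ofReal (Real.exp x)) = 1 := by
      ext x
      simp only [Pi.mul_apply, e, Pi.one_apply]
      rw [← ENNReal.ofReal_mul (Real.exp_pos _).le, ← Real.exp_add]
      simp
    rw [this, withDensity_one]
  rw [← hback μ, key, hback ν]

lemma laplaceTransform_conv (μ ν : Measure ℝ) [SFinite μ] [SFinite ν] (s : ℝ) :
    laplaceTransform (μ ∗ ν) s = laplaceTransform μ s * laplaceTransform ν s := by
  rw [laplaceTransform, Measure.lintegral_conv (by fun_prop)]
  simp_rw [mul_add, Real.exp_add, ENNReal.ofReal_mul (Real.exp_pos _).le]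
  simp_rw [lintegral_const_mul _ (show Measurable fun x : ℝ ↦
    ENNReal.ofReal (Real.exp (-s * x)) by fun_prop)]
  rw [lintegral_mul_const _ (by fun_prop)]
  rfl

lemma conv_Iio_zero {μ ν : Measure ℝ} [SFinite μ] [SFinite ν] (hμ : μ (Iio 0) = 0)
    (hν : ν (Iio 0) = 0) : (μ ∗ ν) (Iio 0) = 0 := by
  rw [← lintegral_indicator_one measurableSet_Iio,
    Measure.lintegral_conv (measurable_one.indicator measurableSet_Iio)]
  refine lintegral_eq_zero_of_ae_eq_zero ?_
  filter_upwards [ae_nonneg_of_measure_Iio hμ] with x hx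
  refine lintegral_eq_zero_of_ae_eq_zero ?_
  filter_upwards [ae_nonneg_of_measure_Iio hν] with y hy
  simp [add_nonneg hx hy]

lemma restrict_Ioi_Iio_zero {μ : Measure ℝ} : μ.restrict (Ioi 0) (Iio 0) = 0 := by
  rw [Measure.restrict_apply measurableSet_Iio, inter_comm, Ioi_inter_Iio, Ioo_self, measure_empty]

/-! ### The error function and improper integrals -/

lemma hasDerivAt_erf (x : ℝ) :
    HasDerivAt erf (2 / Real.sqrt Real.pi * Real.exp (-x ^ 2)) x := by
  have hc : Continuous fun s : ℝ ↦ Real.exp (-s ^ 2) := by fun_prop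
  exact (intervalIntegral.integral_hasDerivAt_right (hc.intervalIntegrable _ _)
    (hc.stronglyMeasurableAtFilter _ _) hc.continuousAt).const_mul _

lemma erf_zero : erf 0 = 0 := by simp [erf]

lemma erf_neg (x : ℝ) : erf (-x) = -erf x := by
  have h := intervalIntegral.integral_comp_neg (a := 0) (b := x) fun s : ℝ ↦ Real.exp (-s ^ 2)
  simp only [even_two.neg_pow, neg_zero] at h
  unfold erf
  rw [h, intervalIntegral.integral_symm 0 (-x)]
  ring

lemma tendsto_erf_atTop : Tendsto erf atTop (𝓝 1) := by
  have hint : IntegrableOn (fun s : ℝ ↦ Real.exp (-s ^ 2)) (Ioi 0) := by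
    simpa using (integrable_exp_neg_mul_sq one_pos).integrableOn
  have hval : ∫ s in Ioi (0 : ℝ), Real.exp (-s ^ 2) = Real.sqrt Real.pi / 2 := by
    simpa using integral_gaussian_Ioi 1
  have h := (intervalIntegral_tendsto_integral_Ioi 0 hint tendsto_id).const_mul
    (2 / Real.sqrt Real.pi)
  rw [hval] at h
  have hpi : Real.sqrt Real.pi ≠ 0 := by positivity
  have e : 2 / Real.sqrt Real.pi * (Real.sqrt Real.pi / 2) = 1 := by field_simp
  rw [e] at h
  exact h

lemma tendsto_erf_atBot : Tendsto erf atBot (𝓝 (-1)) := by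
  have h := (tendsto_erf_atTop.comp tendsto_neg_atBot_atTop).neg
  refine h.congr fun x ↦ ?_
  simp [erf_neg]

lemma continuous_erf : Continuous erf :=
  continuous_iff_continuousAt.2 fun x ↦ (hasDerivAt_erf x).continuousAt

/-- Fundamental theorem of calculus on `(0, ∞)` for a nonnegative derivative; only the limits of
the antiderivative at the two ends are needed. -/
lemma integral_Ioi_zero_of_hasDerivAt_of_nonneg {f f' : ℝ → ℝ} {l m : ℝ}
    (hderiv : ∀ x ∈ Ioi (0 : ℝ), HasDerivAt f (f' x) x) (hpos : ∀ x ∈ Ioi (0 : ℝ), 0 ≤ f' x)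
    (h0 : Tendsto f (𝓝[>] 0) (𝓝 l)) (htop : Tendsto f atTop (𝓝 m)) :
    IntegrableOn f' (Ioi 0) ∧ ∫ x in Ioi 0, f' x = m - l := by
  set F := Function.update f 0 l
  have hF : ∀ x ∈ Ioi (0 : ℝ), F =ᶠ[𝓝 x] f := fun x hx ↦ by
    filter_upwards [Ioi_mem_nhds hx] with y hy
    exact Function.update_of_ne (ne_of_gt hy) _ _
  have hF0 : F 0 = l := Function.update_self _ _ _
  have hcont : ContinuousWithinAt F (Ici 0) 0 := by
    rw [continuousWithinAt_update_same, Ici_sdiff_left]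
    exact h0
  have hd : ∀ x ∈ Ioi (0 : ℝ), HasDerivAt F (f' x) x := fun x hx ↦
    (hderiv x hx).congr_of_eventuallyEq (hF x hx)
  have htop' : Tendsto F atTop (𝓝 m) := htop.congr' <| by
    filter_upwards [Ioi_mem_atTop 0] with y hy
    exact (Function.update_of_ne (ne_of_gt hy) _ _).symm
  exact ⟨integrableOn_Ioi_deriv_of_nonneg hcont hd hpos htop',
    hF0 ▸ integral_Ioi_of_hasDerivAt_of_nonneg hcont hd hpos htop'⟩

lemma lintegral_Ioi_zero_of_hasDerivAt_of_nonneg {f f' : ℝ → ℝ} {l m : ℝ}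
    (hderiv : ∀ x ∈ Ioi (0 : ℝ), HasDerivAt f (f' x) x) (hpos : ∀ x ∈ Ioi (0 : ℝ), 0 ≤ f' x)
    (h0 : Tendsto f (𝓝[>] 0) (𝓝 l)) (htop : Tendsto f atTop (𝓝 m)) :
    ∫⁻ x in Ioi 0, ENNReal.ofReal (f' x) = ENNReal.ofReal (m - l) := by
  obtain ⟨hi, he⟩ := integral_Ioi_zero_of_hasDerivAt_of_nonneg hderiv hpos h0 htop
  rw [← he, ofReal_integral_eq_lintegral_ofReal hi]
  exact (ae_restrict_iff' measurableSet_Ioi).2 (Eventually.of_forall hpos)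

/-! ### The inverse Gaussian kernel -/

lemma smirnovDensity_nonneg {u : ℝ} (hu : 0 ≤ u) {t : ℝ} (ht : 0 < t) :
    0 ≤ smirnovDensity u t := by
  unfold smirnovDensity; positivity

/-- `∫₀^∞ e^{-st} k(u, t) dt = e^{-u√s}`. Up to constants, the antiderivative used is the
distribution function of the first passage time of a Brownian motion with drift, written in terms
of `erf`. -/
lemma lintegral_exp_mul_smirnovDensity {u s : ℝ} (hu : 0 < u) (hs : 0 < s) :
    ∫⁻ t in Ioi (0 : ℝ), ENNReal.ofReal (Real.exp (-s * t) * smirnovDensity u t) =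
      ENNReal.ofReal (Real.exp (-(u * Real.sqrt s))) := by
  set σ := Real.sqrt s
  have hσ : 0 < σ := Real.sqrt_pos.2 hs
  have hσs : s = σ ^ 2 := (Real.sq_sqrt hs.le).symm
  set A : ℝ → ℝ := fun t ↦ u / (2 * Real.sqrt t) - σ * Real.sqrt t
  set B : ℝ → ℝ := fun t ↦ u / (2 * Real.sqrt t) + σ * Real.sqrt t
  set F : ℝ → ℝ := fun t ↦ -(1 / 2) * (Real.exp (-(u * σ)) * erf (A t) +
    Real.exp (u * σ) * erf (B t))
  have hsq0 : Tendsto Real.sqrt (𝓝[>] 0) (𝓝[>] 0) := by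
    refine tendsto_nhdsWithin_iff.2 ⟨?_, ?_⟩
    · exact (by simpa using Real.continuous_sqrt.tendsto 0 :
        Tendsto Real.sqrt (𝓝 0) (𝓝 0)).mono_left nhdsWithin_le_nhds
    · filter_upwards [self_mem_nhdsWithin] with t ht using Real.sqrt_pos.2 ht
  have hd0 : Tendsto (fun t ↦ u / (2 * Real.sqrt t)) (𝓝[>] 0) atTop := by
    have := (tendsto_inv_nhdsGT_zero.comp hsq0).const_mul_atTop (half_pos hu)
    refine this.congr fun t ↦ ?_
    simp only [Function.comp_apply]
    ring
  have hm0 : Tendsto (fun t ↦ σ * Real.sqrt t) (𝓝[>] 0) (𝓝 0) := by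
    simpa using (hsq0.mono_right nhdsWithin_le_nhds).const_mul σ
  have hdtop : Tendsto (fun t ↦ u / (2 * Real.sqrt t)) atTop (𝓝 0) :=
    tendsto_const_nhds.div_atTop (Real.tendsto_sqrt_atTop.const_mul_atTop two_pos)
  have hmtop : Tendsto (fun t ↦ σ * Real.sqrt t) atTop atTop :=
    Real.tendsto_sqrt_atTop.const_mul_atTop hσ
  have hA0 : Tendsto A (𝓝[>] 0) atTop := by
    exact (hd0.atTop_add hm0.neg).congr fun t ↦ (sub_eq_add_neg _ _).symm
  have hB0 : Tendsto B (𝓝[>] 0) atTop := hd0.atTop_add hm0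
  have hAtop : Tendsto A atTop atBot := by
    exact (hdtop.add_atBot (tendsto_neg_atTop_atBot.comp hmtop)).congr fun t ↦
      (sub_eq_add_neg _ _).symm
  have hBtop : Tendsto B atTop atTop := hdtop.add_atTop hmtop
  have hlim0 : Tendsto F (𝓝[>] 0) (𝓝 (-(1 / 2) * (Real.exp (-(u * σ)) * 1 +
      Real.exp (u * σ) * 1))) :=
    (((tendsto_erf_atTop.comp hA0).const_mul _).add
      ((tendsto_erf_atTop.comp hB0).const_mul _)).const_mul _
  have hlimtop : Tendsto F atTop (𝓝 (-(1 / 2) * (Real.exp (-(u * σ)) * (-1) +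
      Real.exp (u * σ) * 1))) :=
    (((tendsto_erf_atBot.comp hAtop).const_mul _).add
      ((tendsto_erf_atTop.comp hBtop).const_mul _)).const_mul _
  have hderiv : ∀ t ∈ Ioi (0 : ℝ),
      HasDerivAt F (Real.exp (-s * t) * smirnovDensity u t) t := by
    intro t ht
    have ht : 0 < t := ht
    -- With `t = y²` the half-integer powers of `t` become integer powers of `y`.
    obtain ⟨y, hy, rfl⟩ : ∃ y, 0 < y ∧ t = y ^ 2 :=
      ⟨Real.sqrt t, Real.sqrt_pos.2 ht, (Real.sq_sqrt ht.le).symm⟩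
    have hsy : Real.sqrt (y ^ 2) = y := Real.sqrt_sq hy.le
    have hs' : HasDerivAt Real.sqrt (1 / (2 * y)) (y ^ 2) := by
      simpa [hsy] using Real.hasDerivAt_sqrt ht.ne'
    have hdiv : HasDerivAt (fun t ↦ u / (2 * Real.sqrt t)) (-(u / (4 * y ^ 3))) (y ^ 2) := by
      have := (hasDerivAt_const (y ^ 2) u).div (hs'.const_mul 2) (by rw [hsy]; positivity)
      refine this.congr_deriv ?_
      rw [hsy]; field_simp; ring
    have hA := hdiv.sub (hs'.const_mul σ)
    have hB := hdiv.add (hs'.const_mul σ)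
    have hF := ((((hasDerivAt_erf (A (y ^ 2))).comp _ hA).const_mul (Real.exp (-(u * σ)))).add
      (((hasDerivAt_erf (B (y ^ 2))).comp _ hB).const_mul (Real.exp (u * σ)))).const_mul (-(1 / 2))
    refine hF.congr_deriv ?_
    -- The cross term of `(u / (2y) ± σy)²` is `±uσ`, which the prefactors `e^{∓uσ}` cancel.
    have hE : ∀ ε v : ℝ, ε ^ 2 = 1 → v = u / (2 * y) + ε * (σ * y) →
        Real.exp (-v ^ 2) = Real.exp (-(ε * (u * σ))) *
          (Real.exp (-s * y ^ 2) * Real.exp (-u ^ 2 / (4 * y ^ 2))) := by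
      rintro ε v hε rfl
      rw [← Real.exp_add, ← Real.exp_add, hσs]
      congr 1
      field_simp
      linear_combination (-16 * σ ^ 2 * y ^ 4) * hε
    have hEA := hE (-1) (A (y ^ 2)) (by norm_num) (by simp only [A, hsy]; ring)
    have hEB := hE 1 (B (y ^ 2)) (by norm_num) (by simp only [B, hsy]; ring)
    have hpow : (y ^ 2) ^ (-(3 / 2) : ℝ) = (y ^ 3)⁻¹ := by
      rw [← Real.rpow_natCast, ← Real.rpow_mul hy.le,
        show ((2 : ℕ) : ℝ) * -(3 / 2) = -((3 : ℕ) : ℝ) by norm_num, Real.rpow_neg hy.le,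
        Real.rpow_natCast]
    rw [hEA, hEB, smirnovDensity, hpow, show -(-1 * (u * σ)) = u * σ by ring, one_mul,
      Real.exp_neg (u * σ)]
    have h1 := Real.exp_ne_zero (u * σ)
    have h2 : Real.sqrt Real.pi ≠ 0 := by positivity
    field_simp
    ring
  rw [lintegral_Ioi_zero_of_hasDerivAt_of_nonneg hderiv
    (fun t ht ↦ mul_nonneg (Real.exp_pos _).le (smirnovDensity_nonneg hu.le ht)) hlim0 hlimtop]
  congr 1
  ring

/-! ### The tempered inverse square root -/

/-- `g(t) = e^{-at} / √(πt)`, with Laplace transform `(s + a)^{-1/2}`. The conventions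
`√y = 0` for `y ≤ 0` and `y / 0 = 0` make it vanish on `(-∞, 0]`. -/
noncomputable def temperedInvSqrt (a t : ℝ) : ℝ :=
  Real.exp (-a * t) / Real.sqrt (Real.pi * t)

lemma temperedInvSqrt_of_nonpos (a : ℝ) {t : ℝ} (ht : t ≤ 0) : temperedInvSqrt a t = 0 := by
  rw [temperedInvSqrt, Real.sqrt_eq_zero_of_nonpos (mul_nonpos_of_nonneg_of_nonpos
    Real.pi_pos.le ht), div_zero]

lemma temperedInvSqrt_nonneg (a t : ℝ) : 0 ≤ temperedInvSqrt a t := by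
  unfold temperedInvSqrt; positivity

@[fun_prop]
lemma measurable_temperedInvSqrt (a : ℝ) : Measurable (temperedInvSqrt a) := by
  unfold temperedInvSqrt; fun_prop

lemma exp_mul_temperedInvSqrt (a s t : ℝ) :
    Real.exp (-s * t) * temperedInvSqrt a t = temperedInvSqrt (s + a) t := by
  rw [temperedInvSqrt, temperedInvSqrt, ← mul_div_assoc, ← Real.exp_add]
  ring_nf

lemma tendsto_sqrt_mul_nhdsGT_zero (b : ℝ) :
    Tendsto (fun t ↦ Real.sqrt (b * t)) (𝓝[>] 0) (𝓝 0) := by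
  have h : Continuous fun t ↦ Real.sqrt (b * t) := by fun_prop
  have h0 := h.tendsto 0
  rw [mul_zero, Real.sqrt_zero] at h0
  exact h0.mono_left nhdsWithin_le_nhds

lemma hasDerivAt_erf_sqrt_mul {b t : ℝ} (hb : 0 < b) (ht : 0 < t) :
    HasDerivAt (fun t ↦ erf (Real.sqrt (b * t)) / Real.sqrt b) (temperedInvSqrt b t) t := by
  have h1 : HasDerivAt (fun t ↦ Real.sqrt (b * t)) (b / (2 * Real.sqrt (b * t))) t := by
    simpa using ((hasDerivAt_id t).const_mul b).sqrt (by positivity)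
  have h := ((hasDerivAt_erf _).comp t h1).div_const (Real.sqrt b)
  refine h.congr_deriv ?_
  have hpi := Real.pi_pos
  have h2 : Real.sqrt Real.pi ≠ 0 := by positivity
  have h3 : Real.sqrt b ≠ 0 := by positivity
  have h4 : Real.sqrt t ≠ 0 := by positivity
  rw [temperedInvSqrt, Real.sq_sqrt (by positivity), Real.sqrt_mul hb.le, Real.sqrt_mul hpi.le,
    show -(b * t) = -b * t by ring]
  field_simp
  rw [Real.sq_sqrt hb.le]

lemma tendsto_erf_sqrt_mul_atTop {b : ℝ} (hb : 0 < b) :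
    Tendsto (fun t ↦ erf (Real.sqrt (b * t)) / Real.sqrt b) atTop (𝓝 (1 / Real.sqrt b)) :=
  (tendsto_erf_atTop.comp (Real.tendsto_sqrt_atTop.comp
    (tendsto_id.const_mul_atTop hb))).div_const _

lemma tendsto_erf_sqrt_mul_nhdsGT_zero (b : ℝ) :
    Tendsto (fun t ↦ erf (Real.sqrt (b * t)) / Real.sqrt b) (𝓝[>] 0) (𝓝 0) := by
  have := ((continuous_erf.tendsto 0).comp (tendsto_sqrt_mul_nhdsGT_zero b)).div_const
    (Real.sqrt b)
  simpa [erf_zero] using this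

lemma lintegral_eq_setLIntegral_Ioi {f : ℝ → ℝ≥0∞} (hf : ∀ t ≤ 0, f t = 0) :
    ∫⁻ t, f t = ∫⁻ t in Ioi 0, f t := by
  refine (setLIntegral_eq_of_support_subset ?_).symm
  intro t ht
  by_contra h
  exact ht (hf t (not_lt.1 h))

lemma lintegral_temperedInvSqrt {b : ℝ} (hb : 0 < b) :
    ∫⁻ t, ENNReal.ofReal (temperedInvSqrt b t) = ENNReal.ofReal (1 / Real.sqrt b) := by
  rw [lintegral_eq_setLIntegral_Ioi fun t ht ↦ by rw [temperedInvSqrt_of_nonpos b ht]; simp,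
    lintegral_Ioi_zero_of_hasDerivAt_of_nonneg (fun t ht ↦ hasDerivAt_erf_sqrt_mul hb ht)
    (fun t _ ↦ temperedInvSqrt_nonneg b t) (tendsto_erf_sqrt_mul_nhdsGT_zero b)
    (tendsto_erf_sqrt_mul_atTop hb), sub_zero]

/-- `g * g = e^{-a·}`, by the arcsine integral `∫₀ᵗ dτ / √(τ(t - τ)) = π`. -/
lemma lintegral_temperedInvSqrt_conv_self (a : ℝ) {t : ℝ} (ht : 0 < t) :
    ∫⁻ τ, ENNReal.ofReal (temperedInvSqrt a (t - τ)) * ENNReal.ofReal (temperedInvSqrt a τ) =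
      ENNReal.ofReal (Real.exp (-a * t)) := by
  set F : ℝ → ℝ := fun τ ↦ Real.exp (-a * t) / Real.pi * Real.arcsin (2 * τ / t - 1)
  set f : ℝ → ℝ := fun τ ↦ temperedInvSqrt a (t - τ) * temperedInvSqrt a τ
  have hpi := Real.pi_pos
  have hf0 : ∀ τ, 0 ≤ f τ := fun τ ↦
    mul_nonneg (temperedInvSqrt_nonneg _ _) (temperedInvSqrt_nonneg _ _)
  have hF : ContinuousOn F (Icc 0 t) := by
    have : Continuous F :=
      (Real.continuous_arcsin.comp (by fun_prop : Continuous fun τ : ℝ ↦ 2 * τ / t - 1)).const_mul _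
    exact this.continuousOn
  have hderiv : ∀ τ ∈ Ioo 0 t, HasDerivAt F (f τ) τ := by
    rintro τ ⟨h0, h1⟩
    have hlin : HasDerivAt (fun τ : ℝ ↦ 2 * τ / t - 1) (2 / t) τ := by
      simpa using (((hasDerivAt_id τ).const_mul 2).div_const t).sub_const 1
    have hlt : 2 * τ / t < 2 := by rw [div_lt_iff₀ ht]; linarith
    have hgt : 0 < 2 * τ / t := by positivity
    have h := ((Real.hasDerivAt_arcsin (x := 2 * τ / t - 1) (by linarith) (by linarith)).comp τ
      hlin).const_mul (Real.exp (-a * t) / Real.pi)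
    refine h.congr_deriv ?_
    have hsub : 0 < t - τ := sub_pos.2 h1
    have hrad : 1 - (2 * τ / t - 1) ^ 2 = (2 / t) ^ 2 * ((t - τ) * τ) := by field_simp; ring
    have e1 : Real.exp (-a * (t - τ)) * Real.exp (-a * τ) = Real.exp (-a * t) := by
      rw [← Real.exp_add]; ring_nf
    simp only [f, temperedInvSqrt]
    rw [div_mul_div_comm (Real.exp (-a * (t - τ))), e1, hrad, Real.sqrt_mul (sq_nonneg _),
      Real.sqrt_sq (by positivity), ← Real.sqrt_mul (by positivity),
      show Real.pi * (t - τ) * (Real.pi * τ) =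
        Real.pi ^ 2 * ((t - τ) * τ) by ring, Real.sqrt_mul (sq_nonneg Real.pi), Real.sqrt_sq hpi.le]
    field_simp
  have hint : IntegrableOn f (Ioc 0 t) :=
    intervalIntegral.integrableOn_deriv_of_nonneg hF hderiv fun τ _ ↦ hf0 τ
  have hval : ∫ τ in (0 : ℝ)..t, f τ = F t - F 0 :=
    intervalIntegral.integral_eq_sub_of_hasDerivAt_of_le ht.le hF hderiv
      ((intervalIntegrable_iff_integrableOn_Ioc_of_le ht.le).2 hint)
  have hval' : F t - F 0 = Real.exp (-a * t) := by
    have h2 : 2 * t / t - 1 = 1 := by field_simp; norm_num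
    simp only [F, h2]
    simp
    field_simp
    norm_num
  rw [intervalIntegral.integral_of_le ht.le, hval'] at hval
  rw [← hval, ofReal_integral_eq_lintegral_ofReal hint (Eventually.of_forall hf0)]
  have hsupp : Function.support (fun τ ↦ ENNReal.ofReal (f τ)) ⊆ Ioc 0 t := by
    intro τ hτ
    by_contra h
    refine hτ ?_
    rcases not_and_or.1 h with h | h
    · simp [f, temperedInvSqrt_of_nonpos a (not_lt.1 h)]
    · simp [f, temperedInvSqrt_of_nonpos a (sub_nonpos.2 (not_le.1 h).le)]
  rw [setLIntegral_eq_of_support_subset hsupp]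
  refine lintegral_congr fun τ ↦ ?_
  rw [← ENNReal.ofReal_mul (temperedInvSqrt_nonneg _ _)]

/-! ### The factor `p` and the Laplace exponent -/

/-- `Γ(-1/2, y) = 2 y^{-1/2} e^{-y} - 2√π (1 - erf √y)`. -/
lemma upperGamma_neg_half {y : ℝ} (hy : 0 < y) :
    upperGamma (-(1 / 2)) y = 2 * Real.exp (-y) / Real.sqrt y -
      2 * Real.sqrt Real.pi * (1 - erf (Real.sqrt y)) := by
  set F : ℝ → ℝ := fun s ↦ -2 * (Real.exp (-s) / Real.sqrt s) -
    2 * Real.sqrt Real.pi * erf (Real.sqrt s)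
  have hderiv : ∀ s ∈ Ici y, HasDerivAt F (s ^ (-(1 / 2) - 1 : ℝ) * Real.exp (-s)) s := by
    intro s hs
    have hs : 0 < s := hy.trans_le hs
    obtain ⟨v, hv, rfl⟩ : ∃ v, 0 < v ∧ s = v ^ 2 :=
      ⟨Real.sqrt s, Real.sqrt_pos.2 hs, (Real.sq_sqrt hs.le).symm⟩
    have hsv : Real.sqrt (v ^ 2) = v := Real.sqrt_sq hv.le
    have h1 : HasDerivAt Real.sqrt (1 / (2 * v)) (v ^ 2) := by
      simpa [hsv] using Real.hasDerivAt_sqrt hs.ne'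
    have h2 : HasDerivAt (fun s : ℝ ↦ Real.exp (-s)) (-Real.exp (-v ^ 2)) (v ^ 2) := by
      simpa using (hasDerivAt_neg (v ^ 2)).exp
    have h := ((h2.div h1 (by rw [hsv]; exact hv.ne')).const_mul (-2)).sub
      (((hasDerivAt_erf _).comp _ h1).const_mul (2 * Real.sqrt Real.pi))
    refine h.congr_deriv ?_
    have hpow : (v ^ 2) ^ (-(1 / 2) - 1 : ℝ) = (v ^ 3)⁻¹ := by
      rw [← Real.rpow_natCast, ← Real.rpow_mul hv.le,
        show ((2 : ℕ) : ℝ) * (-(1 / 2) - 1) = -((3 : ℕ) : ℝ) by norm_num, Real.rpow_neg hv.le,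
        Real.rpow_natCast]
    rw [hpow, hsv]
    have h2 : Real.sqrt Real.pi ≠ 0 := by positivity
    field_simp
    ring
  have htop : Tendsto F atTop (𝓝 (-2 * 0 - 2 * Real.sqrt Real.pi * 1)) := by
    refine Tendsto.sub (Tendsto.const_mul _ ?_)
      ((tendsto_erf_atTop.comp Real.tendsto_sqrt_atTop).const_mul _)
    have h := (Real.tendsto_exp_neg_atTop_nhds_zero).mul
      (tendsto_inv_atTop_zero.comp Real.tendsto_sqrt_atTop)
    simpa [div_eq_mul_inv] using h
  have hpos : ∀ s ∈ Ioi y, 0 ≤ s ^ (-(1 / 2) - 1 : ℝ) * Real.exp (-s) := fun s hs ↦ by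
    have : 0 < s := hy.trans hs
    positivity
  rw [upperGamma, integral_Ioi_of_hasDerivAt_of_nonneg' hderiv hpos htop]
  simp only [F]
  ring

/-- The factor `p` is the tail of the Lévy density, `p(t) = δ₁ / √2 · g(t)` with
`g(t) = e^{-γ²t/2} / √(πt)`: the two error function terms cancel. -/
lemma pFactor_eq {δ₁ γ t : ℝ} (hγ : 0 < γ) (ht : 0 < t) :
    pFactor δ₁ γ t = δ₁ / Real.sqrt 2 * temperedInvSqrt (γ ^ 2 / 2) t := by
  have hy : 0 < γ ^ 2 * t / 2 := by positivity
  have hsq : Real.sqrt (γ ^ 2 * t / 2) = γ * Real.sqrt t / Real.sqrt 2 := by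
    rw [Real.sqrt_div (by positivity), Real.sqrt_mul (by positivity), Real.sqrt_sq hγ.le]
  rw [pFactor, upperGamma_neg_half hy, hsq, temperedInvSqrt, Real.sqrt_mul Real.pi_pos.le,
    show -(γ ^ 2 / 2) * t = -(γ ^ 2 * t / 2) by ring]
  have h1 : Real.sqrt Real.pi ≠ 0 := by positivity
  have h2 : Real.sqrt t ≠ 0 := by positivity
  have h3 : Real.sqrt 2 ≠ 0 := by positivity
  have h4 : Real.sqrt 2 ^ 2 = 2 := Real.sq_sqrt (by norm_num)
  field_simp
  linear_combination (4 * δ₁ * Real.exp (-(γ ^ 2 * t / 2))) * h4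

lemma hasDerivAt_temperedInvSqrt (a : ℝ) {u : ℝ} (hu : 0 < u) :
    HasDerivAt (temperedInvSqrt a)
      (-(u ^ (-(3 / 2) : ℝ) * (1 + 2 * a * u) * Real.exp (-a * u) / (2 * Real.sqrt Real.pi)))
      u := by
  obtain ⟨v, hv, rfl⟩ : ∃ v, 0 < v ∧ u = v ^ 2 :=
    ⟨Real.sqrt u, Real.sqrt_pos.2 hu, (Real.sq_sqrt hu.le).symm⟩
  have hpi := Real.pi_pos
  have hsv : Real.sqrt (Real.pi * v ^ 2) = Real.sqrt Real.pi * v := by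
    rw [Real.sqrt_mul hpi.le, Real.sqrt_sq hv.le]
  have h1 : HasDerivAt (fun u ↦ Real.sqrt (Real.pi * u)) (Real.pi / (2 * (Real.sqrt Real.pi * v)))
      (v ^ 2) := by
    exact (((hasDerivAt_id (v ^ 2)).const_mul Real.pi).sqrt (by positivity)).congr_deriv
      (by simp only [id, mul_one, hsv])
  have h2 : HasDerivAt (fun u : ℝ ↦ Real.exp (-a * u)) (Real.exp (-a * v ^ 2) * (-a)) (v ^ 2) := by
    simpa using ((hasDerivAt_id (v ^ 2)).const_mul (-a)).exp
  refine (h2.div h1 (by rw [hsv]; positivity)).congr_deriv ?_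
  have hpow : (v ^ 2) ^ (-(3 / 2) : ℝ) = (v ^ 3)⁻¹ := by
    rw [← Real.rpow_natCast, ← Real.rpow_mul hv.le,
      show ((2 : ℕ) : ℝ) * -(3 / 2) = -((3 : ℕ) : ℝ) by norm_num, Real.rpow_neg hv.le,
      Real.rpow_natCast]
  rw [hpow, hsv]
  have h3 : Real.sqrt Real.pi ≠ 0 := by positivity
  have h4 : Real.sqrt Real.pi ^ 2 = Real.pi := Real.sq_sqrt hpi.le
  field_simp
  rw [h4]
  ring

/-- `ψ(s) = δ₁ / √2 · s / √(s + γ²/2)`: integrate by parts, the Lévy density being minus the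
derivative of `p`. -/
lemma laplaceExponent_igLevyDensity {δ₁ γ s : ℝ} (hδ : 0 < δ₁) (hγ : 0 < γ) (hs : 0 < s) :
    laplaceExponent (igLevyDensity δ₁ γ) s =
      δ₁ / Real.sqrt 2 * (s / Real.sqrt (s + γ ^ 2 / 2)) := by
  set a : ℝ := γ ^ 2 / 2
  have ha : 0 < a := by positivity
  set K : ℝ := δ₁ / Real.sqrt 2
  have hpi := Real.pi_pos
  set F : ℝ → ℝ := fun u ↦ K * (s * (erf (Real.sqrt ((s + a) * u)) / Real.sqrt (s + a)) -
    (1 - Real.exp (-s * u)) * temperedInvSqrt a u)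
  have hderiv : ∀ u ∈ Ioi (0 : ℝ),
      HasDerivAt F ((1 - Real.exp (-s * u)) * igLevyDensity δ₁ γ u) u := by
    intro u hu
    have hu : 0 < u := hu
    have h1 : HasDerivAt (fun u : ℝ ↦ 1 - Real.exp (-s * u)) (-(Real.exp (-s * u) * (-s))) u := by
      simpa using (((hasDerivAt_id u).const_mul (-s)).exp).const_sub 1
    have h := (((hasDerivAt_erf_sqrt_mul (add_pos hs ha) hu).const_mul s).sub
      (h1.mul (hasDerivAt_temperedInvSqrt a hu))).const_mul K
    refine h.congr_deriv ?_
    rw [← exp_mul_temperedInvSqrt, igLevyDensity, Real.sqrt_mul (by norm_num),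
      show -(γ ^ 2 * u) / 2 = -a * u by simp only [a]; ring,
      show 1 + γ ^ 2 * u = 1 + 2 * a * u by simp only [a]; ring]
    have h1 : Real.sqrt Real.pi ≠ 0 := by positivity
    have h3 : Real.sqrt 2 ≠ 0 := by positivity
    simp only [K]
    field_simp
    ring
  have hpos : ∀ u ∈ Ioi (0 : ℝ), 0 ≤ (1 - Real.exp (-s * u)) * igLevyDensity δ₁ γ u := by
    intro u hu
    have hu : 0 < u := hu
    have : Real.exp (-s * u) ≤ 1 := Real.exp_le_one_iff.2 (by nlinarith)
    refine mul_nonneg (by linarith) ?_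
    unfold igLevyDensity
    positivity
  have hbound : ∀ u, 0 < u → (1 - Real.exp (-s * u)) * temperedInvSqrt a u ≤
      s / Real.pi * Real.sqrt (Real.pi * u) := by
    intro u hu
    have h1 : 1 - Real.exp (-s * u) ≤ s * u := by
      have := Real.add_one_le_exp (-s * u); linarith
    have h2 : Real.exp (-a * u) ≤ 1 := Real.exp_le_one_iff.2 (by nlinarith)
    have h3 : temperedInvSqrt a u ≤ 1 / Real.sqrt (Real.pi * u) := by
      unfold temperedInvSqrt; gcongr
    have h5 : 0 < Real.sqrt (Real.pi * u) := by positivity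
    calc (1 - Real.exp (-s * u)) * temperedInvSqrt a u
        ≤ s * u * (1 / Real.sqrt (Real.pi * u)) := by
          gcongr
          exact temperedInvSqrt_nonneg _ _
      _ = s / Real.pi * Real.sqrt (Real.pi * u) := by
          field_simp; rw [Real.sq_sqrt (by positivity)]
  have hnonneg : ∀ u, 0 < u → 0 ≤ (1 - Real.exp (-s * u)) * temperedInvSqrt a u := by
    intro u hu
    have : Real.exp (-s * u) ≤ 1 := Real.exp_le_one_iff.2 (by nlinarith)
    exact mul_nonneg (by linarith) (temperedInvSqrt_nonneg _ _)
  have hzero : Tendsto (fun u ↦ (1 - Real.exp (-s * u)) * temperedInvSqrt a u) (𝓝[>] 0) (𝓝 0) := by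
    have h := (tendsto_sqrt_mul_nhdsGT_zero Real.pi).const_mul (s / Real.pi)
    rw [mul_zero] at h
    refine tendsto_of_tendsto_of_tendsto_of_le_of_le' tendsto_const_nhds h ?_ ?_
    · filter_upwards [self_mem_nhdsWithin] with u hu using hnonneg u hu
    · filter_upwards [self_mem_nhdsWithin] with u hu using hbound u hu
  have hinf : Tendsto (fun u ↦ (1 - Real.exp (-s * u)) * temperedInvSqrt a u) atTop (𝓝 0) := by
    have h : Tendsto (fun u ↦ Real.exp (-a * u)) atTop (𝓝 0) := by
      refine (Real.tendsto_exp_neg_atTop_nhds_zero.comp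
        (tendsto_id.const_mul_atTop ha)).congr fun u ↦ ?_
      simp
    have h' : Tendsto (fun u ↦ (Real.sqrt (Real.pi * u))⁻¹) atTop (𝓝 0) :=
      tendsto_inv_atTop_zero.comp (Real.tendsto_sqrt_atTop.comp
        (tendsto_id.const_mul_atTop hpi))
    have hg : Tendsto (temperedInvSqrt a) atTop (𝓝 0) := by
      have := h.mul h'
      rw [mul_zero] at this
      exact this
    refine tendsto_of_tendsto_of_tendsto_of_le_of_le' tendsto_const_nhds hg ?_ ?_
    · filter_upwards [Ioi_mem_atTop 0] with u hu using hnonneg u hu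
    · filter_upwards with u
      exact mul_le_of_le_one_left (temperedInvSqrt_nonneg _ _) (by linarith [Real.exp_pos (-s * u)])
  have h0 : Tendsto F (𝓝[>] 0) (𝓝 (K * (s * 0 - 0))) :=
    (((tendsto_erf_sqrt_mul_nhdsGT_zero _).const_mul s).sub hzero).const_mul K
  have htop : Tendsto F atTop (𝓝 (K * (s * (1 / Real.sqrt (s + a)) - 0))) :=
    (((tendsto_erf_sqrt_mul_atTop (add_pos hs ha)).const_mul s).sub hinf).const_mul K
  rw [laplaceExponent, (integral_Ioi_zero_of_hasDerivAt_of_nonneg hderiv hpos h0 htop).2]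
  ring

/-! ### The Bessel measure -/

/-- `I₀` may be differentiated termwise. -/
lemma hasDerivAt_besselI0 (z : ℝ) :
    HasDerivAt besselI0
      (∑' k : ℕ, (z / 2) ^ (2 * k + 1) / ((k + 1).factorial * k.factorial : ℝ)) z := by
  set R : ℝ := |z| + 2
  have hR : 2 ≤ R := by simp [R]
  set g' : ℕ → ℝ → ℝ := fun k y ↦ ((2 * k : ℕ) * (y / 2) ^ (2 * k - 1) * (1 / 2)) /
    (k.factorial : ℝ) ^ 2
  have hbound : ∀ k, ∀ y ∈ Metric.ball (0 : ℝ) R, ‖g' k y‖ ≤ ((R / 2) ^ 2) ^ k / k.factorial := by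
    intro k y hy
    have hy : |y / 2| ≤ R / 2 := by
      rw [mem_ball_zero_iff, Real.norm_eq_abs] at hy
      rw [abs_div, abs_two]; linarith
    have h1 : |y / 2| ^ (2 * k - 1) ≤ (R / 2) ^ (2 * k) :=
      (pow_le_pow_left₀ (abs_nonneg _) hy _).trans
        (pow_le_pow_right₀ (by linarith) (Nat.sub_le _ _))
    have h2 : (k : ℝ) ≤ k.factorial := by exact_mod_cast Nat.self_le_factorial k
    have h3 : (0 : ℝ) < k.factorial := by positivity
    rw [Real.norm_eq_abs]
    simp only [g']
    rw [abs_div, abs_mul, abs_mul, abs_pow, Nat.abs_cast,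
      abs_of_pos (by norm_num : (0 : ℝ) < 1 / 2), abs_of_pos (pow_pos h3 2), ← pow_mul,
      div_le_div_iff₀ (by positivity) h3]
    push_cast
    calc 2 * (k : ℝ) * |y / 2| ^ (2 * k - 1) * (1 / 2) * k.factorial
        = k * |y / 2| ^ (2 * k - 1) * k.factorial := by ring
      _ ≤ k.factorial * (R / 2) ^ (2 * k) * k.factorial := by gcongr
      _ = (R / 2) ^ (2 * k) * (k.factorial : ℝ) ^ 2 := by ring
  have hsum : Summable fun k : ℕ ↦ ((R / 2) ^ 2) ^ k / (k.factorial : ℝ) :=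
    Real.summable_pow_div_factorial _
  have hd : ∀ k, ∀ y ∈ Metric.ball (0 : ℝ) R,
      HasDerivAt (fun y ↦ (y / 2) ^ (2 * k) / (k.factorial : ℝ) ^ 2) (g' k y) y := by
    intro k y _
    exact (((hasDerivAt_id y).div_const 2).pow (2 * k)).div_const _
  have hz : z ∈ Metric.ball (0 : ℝ) R := by simp [R]
  have h0 : (0 : ℝ) ∈ Metric.ball (0 : ℝ) R := by simp; linarith
  have hs0 : Summable fun k : ℕ ↦ ((0 : ℝ) / 2) ^ (2 * k) / (k.factorial : ℝ) ^ 2 :=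
    summable_of_ne_finset_zero (s := {0}) fun k hk ↦ by
      have : k ≠ 0 := by simpa using hk
      simp [this]
  have h := hasDerivAt_tsum_of_isPreconnected hsum Metric.isOpen_ball
    (convex_ball (0 : ℝ) R).isPreconnected hd hbound h0 hs0 hz
  refine h.congr_deriv ?_
  have hgs : Summable fun k ↦ g' k z := Summable.of_norm_bounded hsum fun k ↦ hbound k z hz
  rw [hgs.tsum_eq_zero_add]
  have : g' 0 z = 0 := by simp [g']
  rw [this, zero_add]
  refine tsum_congr fun k ↦ ?_
  have hk : (0 : ℝ) < k.factorial := by positivity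
  simp only [g', show 2 * (k + 1) - 1 = 2 * k + 1 by omega, Nat.factorial_succ]
  push_cast
  field_simp

/-- The density of the Bessel measure is the derivative in `u` of `I₀(2√(cu)) = ∑ₖ (cu)ᵏ / k!²`. -/
lemma deriv_besselI0_mul_sqrt {c u : ℝ} (hc : 0 < c) (hu : 0 < u) :
    deriv besselI0 (2 * Real.sqrt (c * u)) * Real.sqrt (c / u) =
      ∑' k : ℕ, c ^ (k + 1) * u ^ k / ((k + 1).factorial * k.factorial : ℝ) := by
  rw [(hasDerivAt_besselI0 _).deriv, ← tsum_mul_right]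
  refine tsum_congr fun k ↦ ?_
  have h1 : Real.sqrt (c * u) * Real.sqrt (c / u) = c := by
    rw [← Real.sqrt_mul (by positivity), show c * u * (c / u) = c ^ 2 by field_simp,
      Real.sqrt_sq hc.le]
  rw [mul_div_cancel_left₀ _ two_ne_zero, div_mul_eq_mul_div, pow_succ, mul_assoc, h1, pow_mul,
    Real.sq_sqrt (by positivity)]
  ring

lemma lintegral_pow_mul_exp (k : ℕ) {σ : ℝ} (hσ : 0 < σ) :
    ∫⁻ u in Ioi (0 : ℝ), ENNReal.ofReal (u ^ k * Real.exp (-(σ * u))) =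
      ENNReal.ofReal (k.factorial / σ ^ (k + 1)) := by
  have hk : (0 : ℝ) < k + 1 := by positivity
  have hval : ∫ u in Ioi (0 : ℝ), u ^ k * Real.exp (-(σ * u)) = k.factorial / σ ^ (k + 1) := by
    have h := Real.integral_rpow_mul_exp_neg_mul_Ioi hk hσ
    simp only [add_sub_cancel_right, Real.rpow_natCast] at h
    rw [h, Real.Gamma_nat_eq_factorial, ← Nat.cast_succ, Real.rpow_natCast, one_div, inv_pow]
    field_simp
  have hint : IntegrableOn (fun u : ℝ ↦ u ^ k * Real.exp (-(σ * u))) (Ioi 0) := by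
    by_contra h
    rw [integral_undef h] at hval
    have : (0 : ℝ) < k.factorial / σ ^ (k + 1) := by positivity
    exact this.ne hval
  rw [← hval, ofReal_integral_eq_lintegral_ofReal hint]
  refine (ae_restrict_iff' measurableSet_Ioi).2 (Eventually.of_forall fun u hu ↦ ?_)
  have : 0 < u := hu
  positivity

/-- `∫₀^∞ e^{-σu} d/du I₀(2√(cu)) du + 1 = e^{c/σ}`, by integrating the power series termwise. -/
lemma lintegral_exp_mul_deriv_besselI0 {c σ : ℝ} (hc : 0 < c) (hσ : 0 < σ) :
    (∫⁻ u in Ioi (0 : ℝ), ENNReal.ofReal (deriv besselI0 (2 * Real.sqrt (c * u)) *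
      Real.sqrt (c / u)) * ENNReal.ofReal (Real.exp (-(σ * u)))) + 1 =
      ENNReal.ofReal (Real.exp (c / σ)) := by
  have hterm : ∀ u ∈ Ioi (0 : ℝ), ENNReal.ofReal (deriv besselI0 (2 * Real.sqrt (c * u)) *
      Real.sqrt (c / u)) * ENNReal.ofReal (Real.exp (-(σ * u))) =
      ∑' k : ℕ, ENNReal.ofReal (c ^ (k + 1) / ((k + 1).factorial * k.factorial : ℝ)) *
        ENNReal.ofReal (u ^ k * Real.exp (-(σ * u))) := by
    intro u hu
    have hu : 0 < u := hu
    have hsum : Summable fun k : ℕ ↦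
        c ^ (k + 1) * u ^ k / ((k + 1).factorial * k.factorial : ℝ) := by
      refine Summable.of_nonneg_of_le (fun k ↦ by positivity) (fun k ↦ ?_)
        ((Real.summable_pow_div_factorial (c * u)).mul_left c)
      have h1 : (1 : ℝ) ≤ (k + 1).factorial := by exact_mod_cast Nat.factorial_pos (k + 1)
      calc c ^ (k + 1) * u ^ k / ((k + 1).factorial * k.factorial : ℝ)
          ≤ c ^ (k + 1) * u ^ k / (1 * k.factorial : ℝ) := by gcongr
        _ = c * ((c * u) ^ k / k.factorial) := by rw [mul_pow]; ring
    rw [deriv_besselI0_mul_sqrt hc hu, ENNReal.ofReal_tsum_of_nonneg (fun k ↦ by positivity) hsum,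
      ← ENNReal.tsum_mul_right]
    refine tsum_congr fun k ↦ ?_
    rw [← ENNReal.ofReal_mul (by positivity), ← ENNReal.ofReal_mul (by positivity)]
    congr 1
    ring
  have htsum := setLIntegral_congr_fun (μ := volume) measurableSet_Ioi hterm
  rw [lintegral_tsum fun k ↦ by fun_prop] at htsum
  rw [htsum]
  have hk : ∀ k : ℕ, ∫⁻ u in Ioi (0 : ℝ),
      ENNReal.ofReal (c ^ (k + 1) / ((k + 1).factorial * k.factorial : ℝ)) *
        ENNReal.ofReal (u ^ k * Real.exp (-(σ * u))) =
      ENNReal.ofReal ((c / σ) ^ (k + 1) / (k + 1).factorial) := by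
    intro k
    rw [lintegral_const_mul _ (by fun_prop), lintegral_pow_mul_exp k hσ,
      ← ENNReal.ofReal_mul (by positivity)]
    congr 1
    have : (0 : ℝ) < k.factorial := by positivity
    rw [div_pow]
    field_simp
  have hexp := NormedSpace.expSeries_div_summable (𝔸 := ℝ) (c / σ)
  simp_rw [hk]
  rw [Real.exp_eq_exp_ℝ, NormedSpace.exp_eq_tsum_div,
    ENNReal.ofReal_tsum_of_nonneg (fun k ↦ by positivity) hexp,
    tsum_eq_zero_add' (f := fun k : ℕ ↦ ENNReal.ofReal ((c / σ) ^ k / k.factorial))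
      ENNReal.summable, add_comm]
  simp

/-! ### The factors `q` and `r` -/

lemma measurable_smirnovDensity (u : ℝ) : Measurable (smirnovDensity u) := by
  unfold smirnovDensity; fun_prop

lemma smirnovKernel_of_pos {u : ℝ} (hu : 0 < u) : smirnovKernel u =
    (volume.restrict (Ioi 0)).withDensity fun t ↦ ENNReal.ofReal (smirnovDensity u t) :=
  if_pos hu

lemma smirnovKernel_of_nonpos {u : ℝ} (hu : u ≤ 0) : smirnovKernel u = Measure.dirac 0 :=
  if_neg hu.not_gt

lemma laplaceTransform_smirnovKernel {u s : ℝ} (hu : 0 ≤ u) (hs : 0 < s) :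
    laplaceTransform (smirnovKernel u) s = ENNReal.ofReal (Real.exp (-(Real.sqrt s * u))) := by
  rcases hu.eq_or_lt with rfl | hu
  · rw [smirnovKernel_of_nonpos le_rfl, laplaceTransform, lintegral_dirac' _ (by fun_prop)]
    simp
  · rw [smirnovKernel_of_pos hu, laplaceTransform, lintegral_withDensity_eq_lintegral_mul _
      (measurable_smirnovDensity u).ennreal_ofReal (by fun_prop), mul_comm (Real.sqrt s),
      ← lintegral_exp_mul_smirnovDensity hu hs]
    refine lintegral_congr fun t ↦ ?_
    rw [Pi.mul_apply, mul_comm, ENNReal.ofReal_mul (Real.exp_pos _).le]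

lemma smirnovKernel_Iio_zero (u : ℝ) : smirnovKernel u (Iio 0) = 0 := by
  rcases le_or_gt u 0 with hu | hu
  · rw [smirnovKernel_of_nonpos hu, Measure.dirac_apply' _ measurableSet_Iio]
    simp
  · rw [smirnovKernel_of_pos hu]
    exact withDensity_absolutelyContinuous _ _ restrict_Ioi_Iio_zero

lemma smirnovKernel_singleton (u : ℝ) {t : ℝ} (ht : t ≠ 0) : smirnovKernel u {t} = 0 := by
  rcases le_or_gt u 0 with hu | hu
  · rw [smirnovKernel_of_nonpos hu, Measure.dirac_apply' _ (measurableSet_singleton t)]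
    simp [ht.symm]
  · rw [smirnovKernel_of_pos hu]
    exact withDensity_absolutelyContinuous _ _ (measure_singleton t)

lemma besselScale_pos {δ₁ γ x : ℝ} (hδ : 0 < δ₁) (hγ : 0 < γ) (hx : 0 < x) :
    0 < besselScale δ₁ γ x := by
  unfold besselScale; positivity

lemma ae_nonneg_besselMeasure (δ₁ γ x : ℝ) : ∀ᵐ u ∂besselMeasure δ₁ γ x, 0 ≤ u := by
  refine ae_nonneg_of_measure_Iio ?_
  rw [besselMeasure, Measure.add_apply,
    withDensity_absolutelyContinuous _ _ restrict_Ioi_Iio_zero, zero_add,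
    Measure.dirac_apply' _ measurableSet_Iio]
  simp

lemma laplaceTransform_besselMeasure {δ₁ γ x σ : ℝ} (hδ : 0 < δ₁) (hγ : 0 < γ) (hx : 0 < x)
    (hσ : 0 < σ) : laplaceTransform (besselMeasure δ₁ γ x) σ =
      ENNReal.ofReal (Real.exp (besselScale δ₁ γ x / σ)) := by
  have hmeas : Measurable fun u ↦ ENNReal.ofReal
      (deriv besselI0 (2 * Real.sqrt (besselScale δ₁ γ x * u)) *
        Real.sqrt (besselScale δ₁ γ x / u)) := by
    have := measurable_deriv besselI0
    fun_prop
  rw [laplaceTransform, besselMeasure, lintegral_add_measure, lintegral_dirac' _ (by fun_prop),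
    lintegral_withDensity_eq_lintegral_mul _ hmeas (by fun_prop),
    ← lintegral_exp_mul_deriv_besselI0 (besselScale_pos hδ hγ hx) hσ]
  simp [neg_mul]

/-- `q(x, ·)` has Laplace transform `exp(-xγδ₁/2 + c / √(s + γ²/2))`: the kernel `k` replaces the
Laplace variable by its square root, and the exponential tilt shifts it by `γ²/2`. -/
lemma laplaceTransform_qFactor {δ₁ γ x s : ℝ} (hδ : 0 < δ₁) (hγ : 0 < γ) (hx : 0 < x)
    (hs : 0 ≤ s) : laplaceTransform (qFactor δ₁ γ x) s = ENNReal.ofReal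
      (Real.exp (-(x * γ * δ₁) / 2 + besselScale δ₁ γ x / Real.sqrt (s + γ ^ 2 / 2))) := by
  have hb : 0 < s + γ ^ 2 / 2 := by positivity
  have htilt : ∀ t : ℝ, ENNReal.ofReal
      (Real.exp (-(x * γ * δ₁) / 2) * Real.exp (-(t * γ ^ 2) / 2)) *
        ENNReal.ofReal (Real.exp (-s * t)) = ENNReal.ofReal (Real.exp (-(x * γ * δ₁) / 2)) *
        ENNReal.ofReal (Real.exp (-(s + γ ^ 2 / 2) * t)) := by
    intro t
    rw [← ENNReal.ofReal_mul (by positivity), ← ENNReal.ofReal_mul (by positivity), mul_assoc,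
      ← Real.exp_add]
    ring_nf
  rw [laplaceTransform, qFactor, lintegral_withDensity_eq_lintegral_mul _ (by fun_prop)
    (by fun_prop)]
  simp only [Pi.mul_apply, htilt]
  rw [lintegral_const_mul _ (by fun_prop), Measure.lintegral_bind
    smirnovKernel.measurable.aemeasurable (by fun_prop), Real.exp_add,
    ENNReal.ofReal_mul (Real.exp_pos _).le,
    ← laplaceTransform_besselMeasure hδ hγ hx (Real.sqrt_pos.2 hb)]
  congr 1
  refine lintegral_congr_ae ?_
  filter_upwards [ae_nonneg_besselMeasure δ₁ γ x] with u hu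
  rw [neg_mul]
  exact laplaceTransform_smirnovKernel hu hb

lemma isFiniteMeasure_qFactor {δ₁ γ x : ℝ} (hδ : 0 < δ₁) (hγ : 0 < γ) (hx : 0 < x) :
    IsFiniteMeasure (qFactor δ₁ γ x) := by
  have h := laplaceTransform_qFactor hδ hγ hx le_rfl
  refine ⟨?_⟩
  have h' : qFactor δ₁ γ x univ = laplaceTransform (qFactor δ₁ γ x) 0 := by
    simp [laplaceTransform]
  rw [h', h]
  exact ENNReal.ofReal_lt_top

lemma qFactor_Iio_zero (δ₁ γ x : ℝ) : qFactor δ₁ γ x (Iio 0) = 0 := by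
  refine withDensity_absolutelyContinuous _ _ ?_
  rw [Measure.bind_apply measurableSet_Iio smirnovKernel.measurable.aemeasurable]
  simp [smirnovKernel_Iio_zero]

/-- The only atom of `q(x, ·)` is at `0`. -/
lemma qFactor_singleton (δ₁ γ x : ℝ) {t : ℝ} (ht : t ≠ 0) : qFactor δ₁ γ x {t} = 0 := by
  refine withDensity_absolutelyContinuous _ _ ?_
  rw [Measure.bind_apply (measurableSet_singleton t) smirnovKernel.measurable.aemeasurable]
  simp [smirnovKernel_singleton _ ht]

/-- The measure `r(x, t) dt` on `(0, ∞)`. -/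
noncomputable def rMeasure (δ₁ γ x : ℝ) : Measure ℝ :=
  (volume.restrict (Ioi 0)).withDensity fun t ↦ ENNReal.ofReal (rFactor δ₁ γ x t)

@[fun_prop]
lemma measurable_rFactor (δ₁ γ x : ℝ) : Measurable (rFactor δ₁ γ x) := by
  unfold rFactor; fun_prop

/-- `r(x, ·)` is a tilted inverse Gaussian kernel `k(δ₁x/√2, ·)`. -/
lemma rFactor_eq (δ₁ γ x : ℝ) {t : ℝ} (ht : 0 < t) : rFactor δ₁ γ x t =
    Real.exp (x * δ₁ * γ / 2) * (Real.exp (-(γ ^ 2 / 2) * t) *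
      smirnovDensity (δ₁ * x / Real.sqrt 2) t) := by
  obtain ⟨v, hv, rfl⟩ : ∃ v, 0 < v ∧ t = v ^ 2 :=
    ⟨Real.sqrt t, Real.sqrt_pos.2 ht, (Real.sq_sqrt ht.le).symm⟩
  have h2 : Real.sqrt 2 ^ 2 = 2 := Real.sq_sqrt (by norm_num)
  have hpow : ∀ y : ℝ, 0 < y → (y ^ 2) ^ (3 / 2 : ℝ) = y ^ 3 := by
    intro y hy
    rw [← Real.rpow_natCast, ← Real.rpow_mul hy.le,
      show ((2 : ℕ) : ℝ) * (3 / 2) = ((3 : ℕ) : ℝ) by norm_num, Real.rpow_natCast]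
  have e1 : -(δ₁ * x / Real.sqrt 2) ^ 2 / (4 * v ^ 2) = -(δ₁ ^ 2 * x ^ 2) / (8 * v ^ 2) := by
    rw [div_pow, h2]; field_simp; ring
  have e2 : (2 * v ^ 2 : ℝ) = (Real.sqrt 2 * v) ^ 2 := by rw [mul_pow, h2]
  rw [rFactor, smirnovDensity, e1, e2, hpow _ (by positivity), Real.rpow_neg (by positivity),
    hpow _ hv, show -(γ ^ 2 * v ^ 2) / 2 = -(γ ^ 2 / 2) * v ^ 2 by ring]
  have h3 : Real.sqrt 2 ≠ 0 := by positivity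
  have h4 : Real.sqrt Real.pi ≠ 0 := by positivity
  field_simp
  rw [h2]

lemma rFactor_nonneg {δ₁ γ x : ℝ} (hδ : 0 < δ₁) (hx : 0 < x) {t : ℝ} (ht : 0 < t) :
    0 ≤ rFactor δ₁ γ x t := by
  unfold rFactor; positivity

lemma laplaceTransform_rMeasure {δ₁ γ x s : ℝ} (hδ : 0 < δ₁) (hγ : 0 < γ) (hx : 0 < x)
    (hs : 0 < s) : laplaceTransform (rMeasure δ₁ γ x) s = ENNReal.ofReal
      (Real.exp (x * δ₁ * γ / 2 - δ₁ * x / Real.sqrt 2 * Real.sqrt (s + γ ^ 2 / 2))) := by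
  have hb : 0 < s + γ ^ 2 / 2 := by positivity
  have hu : 0 < δ₁ * x / Real.sqrt 2 := by positivity
  rw [laplaceTransform, rMeasure, lintegral_withDensity_eq_lintegral_mul _ (by fun_prop)
    (by fun_prop), sub_eq_add_neg, Real.exp_add, ENNReal.ofReal_mul (Real.exp_pos _).le,
    ← lintegral_exp_mul_smirnovDensity hu hb, ← lintegral_const_mul _
      (by have := measurable_smirnovDensity (δ₁ * x / Real.sqrt 2); fun_prop)]
  refine setLIntegral_congr_fun measurableSet_Ioi fun t ht ↦ ?_
  simp only [Pi.mul_apply]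
  rw [rFactor_eq δ₁ γ x ht, mul_comm, ← ENNReal.ofReal_mul (Real.exp_pos _).le,
    ← ENNReal.ofReal_mul (Real.exp_pos _).le, neg_add, add_mul, Real.exp_add]
  ring_nf

lemma rMeasure_Iio_zero (δ₁ γ x : ℝ) : rMeasure δ₁ γ x (Iio 0) = 0 :=
  withDensity_absolutelyContinuous _ _ restrict_Ioi_Iio_zero

instance (δ₁ γ x : ℝ) : SFinite (rMeasure δ₁ γ x) := by
  unfold rMeasure; infer_instance

/-- `q(x, ·) * r(x, ·)` has Laplace transform `e^{-xψ(s)}`. -/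
lemma laplaceTransform_qFactor_conv_rMeasure {δ₁ γ x s : ℝ} (hδ : 0 < δ₁) (hγ : 0 < γ)
    (hx : 0 < x) (hs : 0 < s) :
    laplaceTransform (qFactor δ₁ γ x ∗ rMeasure δ₁ γ x) s = ENNReal.ofReal
      (Real.exp (-x * (δ₁ / Real.sqrt 2 * (s / Real.sqrt (s + γ ^ 2 / 2))))) := by
  have := isFiniteMeasure_qFactor hδ hγ hx
  rw [laplaceTransform_conv, laplaceTransform_qFactor hδ hγ hx hs.le,
    laplaceTransform_rMeasure hδ hγ hx hs, ← ENNReal.ofReal_mul (Real.exp_pos _).le,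
    ← Real.exp_add]
  congr 2
  have hb : 0 < s + γ ^ 2 / 2 := by positivity
  have h1 : Real.sqrt (s + γ ^ 2 / 2) ≠ 0 := by positivity
  have h2 : Real.sqrt (s + γ ^ 2 / 2) ^ 2 = s + γ ^ 2 / 2 := Real.sq_sqrt hb.le
  have h3 : Real.sqrt 2 ≠ 0 := by positivity
  rw [besselScale]
  generalize Real.sqrt (s + γ ^ 2 / 2) = R at h1 h2 ⊢
  field_simp
  linear_combination (-2) * h2

/-! ### The convolution `(p * q) * r` -/

/-- The function `p`, extended by `0` to `(-∞, 0]`, with values in `[0, ∞]`. -/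
noncomputable def levyTail (K a t : ℝ) : ℝ≥0∞ := ENNReal.ofReal (K * temperedInvSqrt a t)

@[fun_prop]
lemma measurable_levyTail (K a : ℝ) : Measurable (levyTail K a) := by
  unfold levyTail; fun_prop

lemma levyTail_of_nonpos (K a : ℝ) {t : ℝ} (ht : t ≤ 0) : levyTail K a t = 0 := by
  simp [levyTail, temperedInvSqrt_of_nonpos a ht]

lemma lintegral_levyTail {K a : ℝ} (hK : 0 < K) (ha : 0 < a) :
    ∫⁻ t, levyTail K a t = ENNReal.ofReal (K / Real.sqrt a) := by
  simp_rw [levyTail, ENNReal.ofReal_mul hK.le]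
  rw [lintegral_const_mul _ (by fun_prop), lintegral_temperedInvSqrt ha,
    ← ENNReal.ofReal_mul hK.le, mul_one_div]

/-- For `u > 0` the atom of `q(x, ·)` at `0` does not meet the endpoint `τ = u`, where the value of
`p` is immaterial. -/
lemma convMeasure_pFactor_eq {δ₁ γ x u : ℝ} (hδ : 0 < δ₁) (hγ : 0 < γ) (hu : 0 < u) :
    convMeasure (pFactor δ₁ γ) (qFactor δ₁ γ x) u = (∫⁻ τ, levyTail (δ₁ / Real.sqrt 2)
      (γ ^ 2 / 2) (u - τ) ∂qFactor δ₁ γ x).toReal := by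
  set K := δ₁ / Real.sqrt 2
  set a := γ ^ 2 / 2
  have hK : 0 < K := by positivity
  set q := qFactor δ₁ γ x
  have hne : ∀ᵐ τ ∂q, τ ≠ u := by
    rw [ae_iff]; simpa using qFactor_singleton δ₁ γ x hu.ne'
  have h1 : convMeasure (pFactor δ₁ γ) q u = ∫ τ in Icc 0 u, K * temperedInvSqrt a (u - τ) ∂q := by
    refine integral_congr_ae ?_
    filter_upwards [ae_restrict_of_ae hne, ae_restrict_mem measurableSet_Icc] with τ h1 h2
    exact pFactor_eq hγ (sub_pos.2 (lt_of_le_of_ne h2.2 h1))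
  rw [h1, integral_eq_lintegral_of_nonneg_ae
    (Eventually.of_forall fun τ ↦ mul_nonneg hK.le (temperedInvSqrt_nonneg _ _))
    (by fun_prop : Measurable _).aestronglyMeasurable]
  congr 1
  rw [← lintegral_indicator measurableSet_Icc]
  refine lintegral_congr_ae ?_
  filter_upwards [ae_nonneg_of_measure_Iio (qFactor_Iio_zero δ₁ γ x)] with τ hτ
  by_cases h : τ ≤ u
  · rw [indicator_of_mem (show τ ∈ Icc 0 u from ⟨hτ, h⟩)]; rfl
  · rw [indicator_of_notMem (fun h' ↦ h h'.2), levyTail_of_nonpos _ _ (by linarith)]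

/-- `h(x, t) = ∫ p(t - τ) μ(dτ)` with `μ = q(x, ·) * r(x, ·)`. -/
lemma exitDensity_eq {δ₁ γ x t : ℝ} (hδ : 0 < δ₁) (hγ : 0 < γ) (hx : 0 < x) (ht : 0 < t) :
    exitDensity δ₁ γ x t = (∫⁻ τ, levyTail (δ₁ / Real.sqrt 2) (γ ^ 2 / 2) (t - τ)
      ∂(qFactor δ₁ γ x ∗ rMeasure δ₁ γ x)).toReal := by
  set K := δ₁ / Real.sqrt 2
  set a := γ ^ 2 / 2
  have hK : 0 < K := by positivity
  have ha : 0 < a := by positivity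
  set q := qFactor δ₁ γ x
  have hq : IsFiniteMeasure q := isFiniteMeasure_qFactor hδ hγ hx
  have hjoint : Measurable (Function.uncurry fun u τ : ℝ ↦ levyTail K a (u - τ)) := by
    unfold Function.uncurry; fun_prop
  set C : ℝ → ℝ≥0∞ := fun u ↦ ∫⁻ τ, levyTail K a (u - τ) ∂q
  have hC : Measurable C := hjoint.lintegral_prod_right
  have hC0 : ∀ u ≤ 0, C u = 0 := by
    intro u hu
    refine lintegral_eq_zero_of_ae_eq_zero ?_
    filter_upwards [ae_nonneg_of_measure_Iio (qFactor_Iio_zero δ₁ γ x)] with τ hτ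
    exact levyTail_of_nonpos _ _ (by linarith)
  have hCfin : ∀ᵐ u, C u ≠ ∞ := by
    have h : ∫⁻ u, C u = ENNReal.ofReal (K / Real.sqrt a) * q univ := by
      rw [lintegral_lintegral_swap hjoint.aemeasurable]
      simp_rw [fun τ : ℝ ↦ lintegral_sub_right_eq_self (μ := volume) (levyTail K a) τ]
      rw [lintegral_levyTail hK ha, lintegral_const]
    refine (ae_lt_top hC ?_).mono fun u hu ↦ hu.ne
    rw [h]
    exact ENNReal.mul_ne_top ENNReal.ofReal_ne_top (measure_ne_top _ _)
  have hleft : exitDensity δ₁ γ x t =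
      (∫⁻ u in Ioo 0 t, ENNReal.ofReal (rFactor δ₁ γ x (t - u)) * C u).toReal := by
    have h1 : exitDensity δ₁ γ x t = ∫ u in Ioo 0 t, (C u).toReal * rFactor δ₁ γ x (t - u) := by
      rw [exitDensity, convFun, intervalIntegral.integral_of_le ht.le,
        integral_Ioc_eq_integral_Ioo]
      exact setIntegral_congr_fun measurableSet_Ioo fun u hu ↦ by
        rw [convMeasure_pFactor_eq hδ hγ hu.1]
    rw [h1, integral_eq_lintegral_of_nonneg_ae]
    · congr 1
      refine lintegral_congr_ae ?_
      filter_upwards [ae_restrict_of_ae hCfin] with u hu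
      rw [ENNReal.ofReal_mul ENNReal.toReal_nonneg, ENNReal.ofReal_toReal hu, mul_comm]
    · filter_upwards [ae_restrict_mem measurableSet_Ioo] with u hu
      exact mul_nonneg ENNReal.toReal_nonneg (rFactor_nonneg hδ hx (sub_pos.2 hu.2))
    · exact (by fun_prop : Measurable _).aestronglyMeasurable
  rw [hleft, Measure.conv_comm, Measure.lintegral_conv (by fun_prop)]
  congr 1
  simp_rw [← sub_sub]
  change _ = ∫⁻ z, C (t - z) ∂rMeasure δ₁ γ x
  rw [rMeasure, lintegral_withDensity_eq_lintegral_mul _ (by fun_prop) (by fun_prop),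
    ← lintegral_indicator measurableSet_Ioo, ← lintegral_indicator measurableSet_Ioi,
    ← lintegral_sub_left_eq_self (μ := volume) _ t]
  refine lintegral_congr fun z ↦ ?_
  by_cases h1 : 0 < z
  · rw [indicator_of_mem (show z ∈ Ioi 0 from h1)]
    by_cases h2 : z < t
    · rw [indicator_of_mem (show t - z ∈ Ioo 0 t from ⟨by linarith, by linarith⟩)]
      simp
    · rw [indicator_of_notMem (fun h ↦ h2 (by linarith [h.1]))]
      simp [hC0 (t - z) (by linarith)]
  · rw [indicator_of_notMem (show z ∉ Ioi 0 from h1),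
      indicator_of_notMem (fun h ↦ h1 (by linarith [h.2]))]

/-! ### Potential measures -/

lemma laplaceTransform_temperedInvSqrt {a s : ℝ} (hs : 0 < s + a) :
    laplaceTransform (volume.withDensity fun t ↦ ENNReal.ofReal (temperedInvSqrt a t)) s =
      ENNReal.ofReal (1 / Real.sqrt (s + a)) := by
  rw [laplaceTransform, lintegral_withDensity_eq_lintegral_mul _ (by fun_prop) (by fun_prop),
    ← lintegral_temperedInvSqrt hs]
  refine lintegral_congr fun t ↦ ?_
  rw [Pi.mul_apply, ← ENNReal.ofReal_mul (temperedInvSqrt_nonneg _ _), mul_comm,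
    exp_mul_temperedInvSqrt]

lemma lintegral_Ioi_exp_neg_mul {b : ℝ} (hb : 0 < b) :
    ∫⁻ u in Ioi (0 : ℝ), ENNReal.ofReal (Real.exp (-(b * u))) = ENNReal.ofReal (1 / b) := by
  simpa using lintegral_pow_mul_exp 0 hb

lemma laplaceTransform_restrict_Ioi {s : ℝ} (hs : 0 < s) :
    laplaceTransform (volume.restrict (Ioi 0)) s = ENNReal.ofReal (1 / s) := by
  simpa [laplaceTransform] using lintegral_Ioi_exp_neg_mul hs

/-- The measure with Laplace transform `√(s + a) / (Ks)`, the reciprocal of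
`ψ(s) = Ks / √(s + a)`. It comes from `√(s + a) / s = (s + a)^{-1/2} + a s⁻¹ (s + a)^{-1/2}`. -/
noncomputable def potentialMeasure (K a : ℝ) : Measure ℝ :=
  ENNReal.ofReal (1 / K) •
    (volume.withDensity (fun t ↦ ENNReal.ofReal (temperedInvSqrt a t)) +
      ENNReal.ofReal a • (volume.restrict (Ioi 0) ∗
        volume.withDensity fun t ↦ ENNReal.ofReal (temperedInvSqrt a t)))

lemma withDensity_temperedInvSqrt_Iio_zero (a : ℝ) :
    volume.withDensity (fun t ↦ ENNReal.ofReal (temperedInvSqrt a t)) (Iio 0) = 0 := by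
  rw [withDensity_apply _ measurableSet_Iio]
  exact setLIntegral_eq_zero measurableSet_Iio fun t ht ↦ by
    simp [temperedInvSqrt_of_nonpos a (le_of_lt ht)]

lemma potentialMeasure_Iio_zero (K a : ℝ) : potentialMeasure K a (Iio 0) = 0 := by
  simp only [potentialMeasure, Measure.smul_apply, Measure.add_apply,
    withDensity_temperedInvSqrt_Iio_zero, smul_zero, add_zero,
    conv_Iio_zero restrict_Ioi_Iio_zero (withDensity_temperedInvSqrt_Iio_zero a)]

lemma laplaceTransform_potentialMeasure {K a s : ℝ} (hK : 0 < K) (ha : 0 < a) (hs : 0 < s) :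
    laplaceTransform (potentialMeasure K a) s =
      ENNReal.ofReal (1 / (K * (s / Real.sqrt (s + a)))) := by
  have hsa : 0 < s + a := add_pos hs ha
  have h1 := laplaceTransform_temperedInvSqrt hsa
  have h2 := laplaceTransform_conv (volume.restrict (Ioi 0))
    (volume.withDensity fun t ↦ ENNReal.ofReal (temperedInvSqrt a t)) s
  rw [h1, laplaceTransform_restrict_Ioi hs, ← ENNReal.ofReal_mul (by positivity)] at h2
  rw [laplaceTransform] at h1 h2 ⊢
  rw [potentialMeasure, lintegral_smul_measure, lintegral_add_measure, lintegral_smul_measure,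
    h1, h2, smul_eq_mul, smul_eq_mul, ← ENNReal.ofReal_mul ha.le,
    ← ENNReal.ofReal_add (by positivity) (by positivity), ← ENNReal.ofReal_mul (by positivity)]
  congr 1
  have h3 : Real.sqrt (s + a) ^ 2 = s + a := Real.sq_sqrt hsa.le
  have h4 : Real.sqrt (s + a) ≠ 0 := by positivity
  generalize Real.sqrt (s + a) = R at h3 h4 ⊢
  field_simp
  linear_combination -h3

lemma lintegral_temperedInvSqrt_withDensity (a t : ℝ) :
    ∫⁻ τ, ENNReal.ofReal (temperedInvSqrt a (t - τ))
      ∂(volume.withDensity fun t ↦ ENNReal.ofReal (temperedInvSqrt a t)) =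
      (Ioi 0).indicator (fun t ↦ ENNReal.ofReal (Real.exp (-a * t))) t := by
  rw [lintegral_withDensity_eq_lintegral_mul _ (by fun_prop) (by fun_prop)]
  simp only [Pi.mul_apply]
  by_cases ht : 0 < t
  · rw [indicator_of_mem (show t ∈ Ioi 0 from ht), ← lintegral_temperedInvSqrt_conv_self a ht]
    simp_rw [mul_comm]
  · rw [indicator_of_notMem (show t ∉ Ioi 0 from ht)]
    refine lintegral_eq_zero_of_ae_eq_zero (Eventually.of_forall fun τ ↦ ?_)
    rcases le_or_gt τ 0 with h | h
    · simp [temperedInvSqrt_of_nonpos a h]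
    · simp [temperedInvSqrt_of_nonpos a (show t - τ ≤ 0 by linarith)]

lemma lintegral_exp_neg_mul_sub {a t : ℝ} (ha : 0 < a) (ht : 0 < t) :
    ∫⁻ z in Ioc 0 t, ENNReal.ofReal (Real.exp (-a * (t - z))) =
      ENNReal.ofReal ((1 - Real.exp (-a * t)) / a) := by
  have hd : ∀ z, HasDerivAt (fun z ↦ Real.exp (-a * (t - z)) / a) (Real.exp (-a * (t - z))) z := by
    intro z
    have := ((((hasDerivAt_id z).const_sub t).const_mul (-a)).exp).div_const a
    refine this.congr_deriv ?_
    field_simp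
    simp
  have hc : Continuous fun z ↦ Real.exp (-a * (t - z)) := by fun_prop
  have hint := hc.intervalIntegrable (μ := volume) 0 t
  have h := intervalIntegral.integral_eq_sub_of_hasDerivAt (fun z _ ↦ hd z) hint
  rw [intervalIntegral.integral_of_le ht.le] at h
  rw [← ofReal_integral_eq_lintegral_ofReal
    ((intervalIntegrable_iff_integrableOn_Ioc_of_le ht.le).1 hint)
    (Eventually.of_forall fun z ↦ (Real.exp_pos _).le), h]
  congr 1
  simp
  ring

/-- The identity `∫ p(t - τ) U(dτ) = 1` for *every* `t > 0`: without drift, the level `t` is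
almost surely jumped over and not hit. The two parts of `U` contribute `e^{-at}` and
`1 - e^{-at}`. -/
lemma lintegral_levyTail_potentialMeasure {K a : ℝ} (hK : 0 < K) (ha : 0 < a) (t : ℝ) :
    ∫⁻ τ, levyTail K a (t - τ) ∂potentialMeasure K a = (Ioi 0).indicator 1 t := by
  simp_rw [levyTail, ENNReal.ofReal_mul hK.le]
  rw [lintegral_const_mul _ (by fun_prop), potentialMeasure, lintegral_smul_measure,
    lintegral_add_measure, lintegral_smul_measure, lintegral_temperedInvSqrt_withDensity,
    Measure.lintegral_conv (by fun_prop), smul_eq_mul, smul_eq_mul, ← mul_assoc,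
    ← ENNReal.ofReal_mul hK.le, mul_one_div_cancel hK.ne', ENNReal.ofReal_one, one_mul]
  simp_rw [← sub_sub, lintegral_temperedInvSqrt_withDensity]
  by_cases ht : 0 < t
  · have hmem : t ∈ Ioi (0 : ℝ) := ht
    have h1 : ∫⁻ z in Ioi 0,
        (Ioi 0).indicator (fun t ↦ ENNReal.ofReal (Real.exp (-a * t))) (t - z) =
        ∫⁻ z in Ioc 0 t, ENNReal.ofReal (Real.exp (-a * (t - z))) := by
      rw [← restrict_Ioo_eq_restrict_Ioc, ← lintegral_indicator measurableSet_Ioo,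
        ← lintegral_indicator measurableSet_Ioi]
      refine lintegral_congr fun z ↦ ?_
      simp only [indicator_apply, mem_Ioi, mem_Ioo, sub_pos]
      by_cases h0 : 0 < z <;> by_cases hz : z < t <;> simp [h0, hz]
    have hle : Real.exp (-a * t) ≤ 1 := Real.exp_le_one_iff.2 (by nlinarith)
    rw [h1, lintegral_exp_neg_mul_sub ha ht, indicator_of_mem hmem, indicator_of_mem hmem,
      ← ENNReal.ofReal_mul ha.le, mul_div_cancel₀ _ ha.ne',
      ← ENNReal.ofReal_add (Real.exp_pos _).le (by linarith)]
    simp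
  · have hmem : t ∉ Ioi (0 : ℝ) := ht
    rw [indicator_of_notMem hmem, indicator_of_notMem hmem, zero_add]
    refine mul_eq_zero_of_right _ (lintegral_eq_zero_of_ae_eq_zero ?_)
    filter_upwards [ae_restrict_mem measurableSet_Ioi] with z hz
    have hz : 0 < z := hz
    exact indicator_of_notMem (fun h ↦ ht (by linarith [mem_Ioi.1 h])) _

/-- The measures `κ x`, `x ≥ 0`, live on `[0, ∞)` and have the Laplace transforms `e^{-xψ}` with
`ψ(s) = Ks / √(s + a)`; the values of `κ` at negative `x` play no role. -/
structure IsLaplaceSemigroup (κ : Kernel ℝ ℝ) (K a : ℝ) : Prop where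
  Iio_zero : ∀ x, 0 ≤ x → κ x (Iio 0) = 0
  laplace : ∀ x, 0 ≤ x → ∀ s, 0 < s →
    laplaceTransform (κ x) s = ENNReal.ofReal (Real.exp (-x * (K * (s / Real.sqrt (s + a)))))

namespace IsLaplaceSemigroup

variable {κ : Kernel ℝ ℝ} {K a : ℝ}

lemma conv [IsMarkovKernel κ] (h : IsLaplaceSemigroup κ K a) {x y : ℝ} (hx : 0 ≤ x) (hy : 0 ≤ y) :
    κ (x + y) = κ x ∗ κ y := by
  have hL := h.laplace _ (add_nonneg hx hy)
  refine measure_ext_of_laplaceTransform (h.Iio_zero _ (add_nonneg hx hy))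
    (conv_Iio_zero (h.Iio_zero x hx) (h.Iio_zero y hy)) ?_ fun s hs ↦ ?_
  · rw [hL 1 one_pos]
    exact ENNReal.ofReal_ne_top
  · rw [hL s hs, laplaceTransform_conv, h.laplace x hx s hs, h.laplace y hy s hs,
      ← ENNReal.ofReal_mul (Real.exp_pos _).le, ← Real.exp_add]
    ring_nf

/-- `∫₀^∞ μ_x dx` is the potential measure. -/
lemma bind_eq (h : IsLaplaceSemigroup κ K a) (hK : 0 < K) (ha : 0 < a) :
    (volume.restrict (Ioi 0)).bind κ = potentialMeasure K a := by
  have hL : ∀ s, 0 < s → laplaceTransform ((volume.restrict (Ioi 0)).bind κ) s =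
      laplaceTransform (potentialMeasure K a) s := by
    intro s hs
    have hψ : 0 < K * (s / Real.sqrt (s + a)) := by positivity
    rw [laplaceTransform, Measure.lintegral_bind κ.measurable.aemeasurable (by fun_prop),
      laplaceTransform_potentialMeasure hK ha hs, ← lintegral_Ioi_exp_neg_mul hψ]
    refine setLIntegral_congr_fun measurableSet_Ioi fun x hx ↦ ?_
    have := h.laplace x (le_of_lt hx) s hs
    rw [laplaceTransform] at this
    rw [this]
    ring_nf
  refine measure_ext_of_laplaceTransform ?_ (potentialMeasure_Iio_zero K a) ?_ hL
  · rw [Measure.bind_apply measurableSet_Iio κ.measurable.aemeasurable]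
    exact setLIntegral_eq_zero measurableSet_Ioi fun x hx ↦ h.Iio_zero x (le_of_lt hx)
  · rw [hL 1 one_pos, laplaceTransform_potentialMeasure hK ha one_pos]
    exact ENNReal.ofReal_ne_top

/-- The Markov property at time `x` reduces the tail integral to the potential measure:
`∫ₓ^∞ (p * μ_v)(t) dv = (μ_x * (p * U))(t) = μ_x(-∞, t)`. -/
lemma lintegral_Ioi_levyTail [IsMarkovKernel κ] (h : IsLaplaceSemigroup κ K a) (hK : 0 < K)
    (ha : 0 < a) {x : ℝ} (hx : 0 ≤ x) (t : ℝ) :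
    ∫⁻ v in Ioi x, ∫⁻ τ, levyTail K a (t - τ) ∂κ v = κ x (Iio t) := by
  have hshift : ∫⁻ v in Ioi x, ∫⁻ τ, levyTail K a (t - τ) ∂κ v =
      ∫⁻ v in Ioi 0, ∫⁻ τ, levyTail K a (t - τ) ∂κ (x + v) := by
    rw [← lintegral_indicator measurableSet_Ioi, ← lintegral_indicator measurableSet_Ioi,
      ← lintegral_add_left_eq_self (μ := volume) _ x]
    refine lintegral_congr fun v ↦ ?_
    simp [indicator_apply]
  have hmeas : Measurable fun w : ℝ × ℝ ↦ ∫⁻ z, levyTail K a (t - w.2 - z) ∂κ w.1 := by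
    have : Measurable fun w : (ℝ × ℝ) × ℝ ↦ levyTail K a (t - w.1.2 - w.2) := by fun_prop
    exact Measurable.lintegral_kernel_prod_right (κ := κ.comap Prod.fst measurable_fst) this
  calc ∫⁻ v in Ioi x, ∫⁻ τ, levyTail K a (t - τ) ∂κ v
      = ∫⁻ v in Ioi 0, ∫⁻ y, ∫⁻ z, levyTail K a (t - y - z) ∂κ v ∂κ x := by
        rw [hshift]
        refine setLIntegral_congr_fun measurableSet_Ioi fun v hv ↦ ?_
        rw [h.conv hx (le_of_lt hv), Measure.lintegral_conv (by fun_prop)]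
        simp_rw [sub_sub]
    _ = ∫⁻ y, (∫⁻ v in Ioi 0, ∫⁻ z, levyTail K a (t - y - z) ∂κ v) ∂κ x :=
        lintegral_lintegral_swap hmeas.aemeasurable
    _ = ∫⁻ y, (Iio t).indicator 1 y ∂κ x := by
        refine lintegral_congr fun y ↦ ?_
        rw [← Measure.lintegral_bind κ.measurable.aemeasurable (by fun_prop), h.bind_eq hK ha,
          lintegral_levyTail_potentialMeasure hK ha]
        simp [indicator_apply]
    _ = κ x (Iio t) := lintegral_indicator_one measurableSet_Iio

/-- Markov's inequality for `e^{-·}`. -/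
lemma measure_Iio_le (h : IsLaplaceSemigroup κ K a) {x : ℝ} (hx : 0 ≤ x) (t : ℝ) :
    κ x (Iio t) ≤ ENNReal.ofReal
      (Real.exp t * Real.exp (-x * (K * (1 / Real.sqrt (1 + a))))) := by
  rw [ENNReal.ofReal_mul (Real.exp_pos _).le, ← h.laplace x hx 1 one_pos, laplaceTransform,
    ← lintegral_const_mul _ (by fun_prop), ← lintegral_indicator_one measurableSet_Iio]
  refine lintegral_mono fun y ↦ ?_
  refine indicator_apply_le' (fun hy ↦ ?_) (fun _ ↦ zero_le)
  rw [← ENNReal.ofReal_mul (Real.exp_pos _).le, ← Real.exp_add, Pi.one_apply,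
    ENNReal.one_le_ofReal, Real.one_le_exp_iff]
  linarith [mem_Iio.1 hy]

lemma tendsto_measure_Iio (h : IsLaplaceSemigroup κ K a) (hK : 0 < K) (ha : 0 < a) (t : ℝ) :
    Tendsto (fun x ↦ κ x (Iio t)) atTop (𝓝 0) := by
  have hψ : 0 < K * (1 / Real.sqrt (1 + a)) := by positivity
  have hlim : Tendsto (fun x : ℝ ↦ ENNReal.ofReal
      (Real.exp t * Real.exp (-x * (K * (1 / Real.sqrt (1 + a)))))) atTop (𝓝 0) := by
    rw [← ENNReal.ofReal_zero, ← mul_zero (Real.exp t)]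
    refine ENNReal.tendsto_ofReal (Tendsto.const_mul _ ?_)
    refine Real.tendsto_exp_atBot.comp ?_
    exact tendsto_neg_atTop_atBot.atBot_mul_const hψ
  refine tendsto_of_tendsto_of_tendsto_of_le_of_le' tendsto_const_nhds hlim
    (Eventually.of_forall fun _ ↦ zero_le) ?_
  filter_upwards [Ici_mem_atTop 0] with x hx using h.measure_Iio_le hx t

end IsLaplaceSemigroup

/-! ### One-dimensional laws and first-exit times of a subordinator -/

namespace IsSubordinator

variable {Ω : Type*} [MeasurableSpace Ω] {P : Measure Ω} {Z : ℝ≥0 → Ω → ℝ}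

lemma ae_nonneg (hZ : IsSubordinator Z P) : ∀ᵐ ω ∂P, ∀ τ, 0 ≤ Z τ ω := by
  filter_upwards [hZ.zero, hZ.mono] with ω h0 hm τ
  rw [← h0]
  exact hm (by simp)

/-- Since the paths are nondecreasing and right-continuous, `T_t > x` if and only if `Z_x < t`. -/
lemma ae_lt_firstExit_iff (hZ : IsSubordinator Z P) {t : ℝ} (ht : 0 < t)
    (hex : ∀ᵐ ω ∂P, ∃ τ : ℝ≥0, 0 < τ ∧ t ≤ Z τ ω) :
    ∀ᵐ ω ∂P, ∀ x : ℝ, 0 ≤ x → (x < firstExit Z t ω ↔ Z x.toNNReal ω < t) := by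
  filter_upwards [hZ.zero, hZ.mono, hZ.rightCont, hex] with ω h0 hm hc hne x hx
  lift x to ℝ≥0 using hx
  rw [Real.toNNReal_coe, firstExit, NNReal.coe_lt_coe]
  constructor
  · intro h
    by_contra hle
    have hle : t ≤ Z x ω := not_lt.1 hle
    have hx : 0 < x := by
      refine pos_iff_ne_zero.2 fun hx ↦ ?_
      rw [hx, h0] at hle
      exact absurd hle ht.not_ge
    have hmem : x ∈ {τ : ℝ≥0 | 0 < τ ∧ t ≤ Z τ ω} := ⟨hx, hle⟩
    exact absurd (csInf_le (OrderBot.bddBelow _) hmem) h.not_ge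
  · intro h
    have hev : ∀ᶠ y in 𝓝[>] x, Z y ω < t :=
      ((hc x).eventually (gt_mem_nhds h)).filter_mono (nhdsWithin_mono _ Ioi_subset_Ici_self)
    obtain ⟨y, hy, hxy⟩ := (hev.and self_mem_nhdsWithin).exists
    refine (mem_Ioi.1 hxy).trans_le (le_csInf hne fun τ hτ ↦ ?_)
    by_contra hlt
    exact absurd (hτ.2.trans (hm (not_le.1 hlt).le)) hy.not_ge

lemma aemeasurable_firstExit (hZ : IsSubordinator Z P) {t : ℝ} (ht : 0 < t)
    (hex : ∀ᵐ ω ∂P, ∃ τ : ℝ≥0, 0 < τ ∧ t ≤ Z τ ω) : AEMeasurable (firstExit Z t) P := by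
  refine NullMeasurable.aemeasurable ?_
  have h : @Measurable (NullMeasurableSpace Ω P) ℝ _ _ (firstExit Z t) := by
    refine measurable_of_Ioi fun x ↦ ?_
    change NullMeasurableSet (firstExit Z t ⁻¹' Ioi x) P
    rcases lt_or_ge x 0 with hx | hx
    · have : firstExit Z t ⁻¹' Ioi x = univ :=
        eq_univ_of_forall fun ω ↦ hx.trans_le (NNReal.coe_nonneg _)
      rw [this]
      exact nullMeasurableSet_univ
    · refine NullMeasurableSet.congr
        (hZ.measurable x.toNNReal (measurableSet_Iio (a := t))).nullMeasurableSet ?_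
      filter_upwards [hZ.ae_lt_firstExit_iff ht hex] with ω hω
      exact propext (hω x hx).symm
  exact h

/-- The laws of `Z_x`, `x ≥ 0`, as a kernel (constant for `x ≤ 0`). Measurability in `x` holds
because `x ↦ P(Z_x < t)` is antitone. -/
noncomputable def lawKernel [IsProbabilityMeasure P] (hZ : IsSubordinator Z P) : Kernel ℝ ℝ where
  toFun x := P.map (Z x.toNNReal)
  measurable' := by
    have : ∀ x : ℝ, IsProbabilityMeasure (P.map (Z x.toNNReal)) := fun x ↦
      Measure.isProbabilityMeasure_map (hZ.measurable _).aemeasurable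
    refine Measurable.measure_of_isPiSystem_of_isProbabilityMeasure
      ((BorelSpace.measurable_eq (α := ℝ)).trans (borel_eq_generateFrom_Iio ℝ)) isPiSystem_Iio ?_
    rintro _ ⟨t, rfl⟩
    refine Antitone.measurable fun x y hxy ↦ ?_
    rw [Measure.map_apply (hZ.measurable _) measurableSet_Iio,
      Measure.map_apply (hZ.measurable _) measurableSet_Iio]
    refine measure_mono_ae ?_
    filter_upwards [hZ.mono] with ω hm h
    exact (hm (Real.toNNReal_le_toNNReal hxy)).trans_lt h

variable [IsProbabilityMeasure P]

instance (hZ : IsSubordinator Z P) : IsMarkovKernel hZ.lawKernel :=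
  ⟨fun _ ↦ Measure.isProbabilityMeasure_map (hZ.measurable _).aemeasurable⟩

lemma lawKernel_apply (hZ : IsSubordinator Z P) (x : ℝ) :
    hZ.lawKernel x = P.map (Z x.toNNReal) := rfl

lemma lawKernel_Iio (hZ : IsSubordinator Z P) (x t : ℝ) :
    hZ.lawKernel x (Iio t) = P {ω | Z x.toNNReal ω < t} :=
  Measure.map_apply (hZ.measurable _) measurableSet_Iio

lemma isLaplaceSemigroup {δ₁ γ : ℝ} (hδ : 0 < δ₁) (hγ : 0 < γ) (hZ : IsSubordinator Z P)
    (hw : HasLevyDensity Z (igLevyDensity δ₁ γ) P) :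
    IsLaplaceSemigroup hZ.lawKernel (δ₁ / Real.sqrt 2) (γ ^ 2 / 2) where
  Iio_zero x _ := by
    rw [lawKernel_Iio]
    refine measure_mono_null (fun ω hω ↦ ?_) (ae_iff.1 hZ.ae_nonneg)
    simp only [mem_ofPred_eq, not_forall, not_le] at hω ⊢
    exact ⟨_, hω⟩
  laplace x hx s hs := by
    have h := hw.laplace x.toNNReal s hs.le
    rw [laplaceExponent_igLevyDensity hδ hγ hs, Real.coe_toNNReal x hx] at h
    have hint : Integrable (fun ω ↦ Real.exp (-s * Z x.toNNReal ω)) P := by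
      by_contra hni
      rw [integral_undef hni] at h
      exact (Real.exp_pos _).ne h
    rw [laplaceTransform, lawKernel_apply, lintegral_map (by fun_prop) (hZ.measurable _), ← h,
      ofReal_integral_eq_lintegral_ofReal hint (Eventually.of_forall fun ω ↦ (Real.exp_pos _).le)]

lemma ae_exists_le {K a : ℝ} (hZ : IsSubordinator Z P) (hK : 0 < K) (ha : 0 < a)
    (h : IsLaplaceSemigroup hZ.lawKernel K a) (t : ℝ) :
    ∀ᵐ ω ∂P, ∃ τ : ℝ≥0, 0 < τ ∧ t ≤ Z τ ω := by
  rw [ae_iff, ← nonpos_iff_eq_zero]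
  refine ge_of_tendsto (h.tendsto_measure_Iio hK ha t) ?_
  filter_upwards [Ioi_mem_atTop 0] with x hx
  rw [lawKernel_Iio]
  refine measure_mono fun ω hω ↦ ?_
  simp only [mem_ofPred_eq, not_exists, not_and, not_le] at hω ⊢
  exact hω _ (Real.toNNReal_pos.2 hx)

lemma measure_lt_firstExit (hZ : IsSubordinator Z P) {t : ℝ} (ht : 0 < t)
    (hex : ∀ᵐ ω ∂P, ∃ τ : ℝ≥0, 0 < τ ∧ t ≤ Z τ ω) {x : ℝ} (hx : 0 ≤ x) :
    P (firstExit Z t ⁻¹' Ioi x) = hZ.lawKernel x (Iio t) := by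
  rw [lawKernel_Iio]
  refine measure_congr ?_
  filter_upwards [hZ.ae_lt_firstExit_iff ht hex] with ω hω
  exact propext (hω x hx)

end IsSubordinator

/-! ### The law of the first-exit time -/

theorem mainTheorem6 {Ω : Type*} [MeasurableSpace Ω] (P : Measure Ω) [IsProbabilityMeasure P]
    (δ₁ γ : ℝ) (hδ : 0 < δ₁) (hγ : 0 < γ) (Z : ℝ≥0 → Ω → ℝ) (hZ : IsSubordinator Z P)
    (hw : HasLevyDensity Z (igLevyDensity δ₁ γ) P) (t : ℝ) (ht : 0 < t) :
    (∀ᵐ ω ∂P, ∃ τ : ℝ≥0, 0 < τ ∧ t ≤ Z τ ω) ∧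
    AEMeasurable (firstExit Z t) P ∧
    (∀ x, 0 < x → 0 ≤ exitDensity δ₁ γ x t) ∧
    AEMeasurable (fun x ↦ exitDensity δ₁ γ x t) (volume.restrict (Ioi 0)) ∧
    P.map (firstExit Z t) =
      (volume.restrict (Ioi 0)).withDensity fun x ↦ ENNReal.ofReal (exitDensity δ₁ γ x t) := by
  set K := δ₁ / Real.sqrt 2
  set a := γ ^ 2 / 2
  have hK : 0 < K := by positivity
  have ha : 0 < a := by positivity
  set κ := hZ.lawKernel
  have hκ : IsLaplaceSemigroup κ K a := hZ.isLaplaceSemigroup hδ hγ hw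
  set H : ℝ → ℝ≥0∞ := fun x ↦ ∫⁻ τ, levyTail K a (t - τ) ∂κ x
  have hH : Measurable H :=
    (by fun_prop : Measurable fun τ ↦ levyTail K a (t - τ)).lintegral_kernel
  have htail : ∀ x, 0 ≤ x → ∫⁻ v in Ioi x, H v = κ x (Iio t) := fun x hx ↦
    hκ.lintegral_Ioi_levyTail hK ha hx t
  have hlaw : ∀ x, 0 < x → κ x = qFactor δ₁ γ x ∗ rMeasure δ₁ γ x := by
    intro x hx
    have := isFiniteMeasure_qFactor hδ hγ hx
    refine measure_ext_of_laplaceTransform (hκ.Iio_zero x hx.le)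
      (conv_Iio_zero (qFactor_Iio_zero δ₁ γ x) (rMeasure_Iio_zero δ₁ γ x)) ?_ fun s hs ↦ ?_
    · rw [hκ.laplace x hx.le 1 one_pos]
      exact ENNReal.ofReal_ne_top
    · rw [hκ.laplace x hx.le s hs, laplaceTransform_qFactor_conv_rMeasure hδ hγ hx hs]
  have hexit : ∀ x, 0 < x → exitDensity δ₁ γ x t = (H x).toReal := by
    intro x hx
    rw [exitDensity_eq hδ hγ hx ht, ← hlaw x hx]
  have hex := hZ.ae_exists_le hK ha hκ t
  have hT := hZ.aemeasurable_firstExit ht hex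
  refine ⟨hex, hT, fun x hx ↦ hexit x hx ▸ ENNReal.toReal_nonneg, ?_, ?_⟩
  · refine hH.ennreal_toReal.aemeasurable.congr ?_
    filter_upwards [ae_restrict_mem measurableSet_Ioi] with x hx using (hexit x hx).symm
  have hfin : ∀ᵐ x ∂volume.restrict (Ioi 0), H x < ∞ := by
    refine ae_lt_top hH ?_
    rw [htail 0 le_rfl]
    exact measure_ne_top _ _
  have hdens : (volume.restrict (Ioi 0)).withDensity
      (fun x ↦ ENNReal.ofReal (exitDensity δ₁ γ x t)) =
        (volume.restrict (Ioi 0)).withDensity H := by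
    refine withDensity_congr_ae ?_
    filter_upwards [ae_restrict_mem measurableSet_Ioi, hfin] with x hx hx'
    rw [hexit x hx, ENNReal.ofReal_toReal hx'.ne]
  have hzero : κ 0 (Iio t) = 1 := by
    rw [hZ.lawKernel_Iio, Real.toNNReal_zero, ← measure_univ (μ := P)]
    refine measure_congr ?_
    filter_upwards [hZ.zero] with ω hω
    exact eq_true (show Z 0 ω < t by rw [hω]; exact ht)
  have htotal : (volume.restrict (Ioi 0)).withDensity H univ = 1 := by
    rw [withDensity_apply _ MeasurableSet.univ, Measure.restrict_univ, htail 0 le_rfl, hzero]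
  have hprob : IsProbabilityMeasure (P.map (firstExit Z t)) := Measure.isProbabilityMeasure_map hT
  rw [hdens]
  -- The two measures have total mass `1` and agree on the half-lines `(x, ∞)`.
  refine ext_of_generate_finite (range Ioi)
    ((BorelSpace.measurable_eq (α := ℝ)).trans (borel_eq_generateFrom_Ioi ℝ)) isPiSystem_Ioi ?_
    (by rw [measure_univ, htotal])
  rintro _ ⟨x, rfl⟩
  rw [Measure.map_apply_of_aemeasurable hT measurableSet_Ioi, withDensity_apply _ measurableSet_Ioi,
    Measure.restrict_restrict measurableSet_Ioi]
  rcases lt_or_ge x 0 with hx | hx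
  · have h1 : firstExit Z t ⁻¹' Ioi x = univ :=
      eq_univ_of_forall fun ω ↦ hx.trans_le (NNReal.coe_nonneg _)
    rw [h1, measure_univ, inter_eq_right.2 (Ioi_subset_Ioi hx.le), htail 0 le_rfl, hzero]
  · rw [inter_eq_left.2 (Ioi_subset_Ioi hx), htail x hx, hZ.measure_lt_firstExit ht hex hx]
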